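/- Let $\mathcal{L}$ be a first-order language with countably many predicate, function and constant symbols, and variables $x_0,x_1,\dots$. Formulas of the rational G\"odel logic $RGL^*$ are built from atomic formulas and the nullary connectives $\bar r$ ($r\in[0,1]\cap\mathbb{Q}$) by $\wedge,\to,\forall,\exists$, with the abbreviations $\neg\varphi:=\varphi\to\bar 1$, $\varphi\vee\psi:=((\varphi\to\psi)\to\psi)\wedge((\psi\to\varphi)\to\varphi)$ and $\varphi\leftrightarrow\psi:=(\varphi\to\psi)\wedge(\psi\to\varphi)$. A theory is an arbitrary set of sentences. Semantics. Let $\mathbb{I}=[0,1]^2\setminus\{(0,r):r>0\}$ with the lexicographic order, which is complete, and $\hat r=(r,r)$; here $\hat 0$ is truth and $\hat 1$ is falsity. A structure $\mathcal{M}$ is a nonempty set $M$ with a function $M^n\to M$ for each $n$-ary function symbol, an element of $M$ for each constant symbol, and a function $M^n\to\mathbb{I}$ for each $n$-ary predicate symbol. Formulas are evaluated in $\mathbb{I}$ by: $\bar r$ has the value $\hat r$; the value of $\varphi\wedge\psi$ is the maximum of the two values; the value of $\varphi\to\psi$ is $\hat 0$ if the value of $\varphi$ is $\ge$ the value of $\psi$,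 and the value of $\psi$ otherwise; the values of $\forall x\,\varphi$ and $\exists x\,\varphi$ are the supremum and the infimum, respectively, of the values of $\varphi$ as $x$ ranges over $M$. $\mathcal{M}$ is a model of a theory $T$ if every sentence of $T$ has the value $\hat 0$ in $\mathcal{M}$. Proof system. The axioms are, for all formulas $\varphi,\psi,\chi$, all variables $x$, all terms $t$ and all $r,s\in[0,1]\cap\mathbb{Q}$: $(\varphi\to\psi)\to((\psi\to\chi)\to(\varphi\to\chi))$; $(\varphi\wedge\psi)\to\varphi$; $(\varphi\wedge\psi)\to(\psi\wedge\varphi)$; $\varphi\to(\varphi\wedge\varphi)$; $(\varphi\to(\psi\to\chi))\leftrightarrow((\varphi\wedge\psi)\to\chi)$; $((\varphi\to\psi)\to\chi)\to(((\psi\to\varphi)\to\chi)\to\chi)$; $\bar 1\to\varphi$; $\forall x\,\varphi(x)\to\varphi(t)$ and $\varphi(t)\to\exists x\,\varphi(x)$, for $t$ substitutable for $x$ in $\varphi$; $\forall x(\psi\to\varphi)\to(\psi\to\forall x\,\varphi)$, $\forall x(\psi\vee\varphi)\to(\psi\vee\forall x\,\varphi)$ and $\forall x(\varphi\to\psi)\to((\exists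 x\,\varphi)\to\psi)$, for $x$ not free in $\psi$; $(\bar r\wedge\bar s)\leftrightarrow\overline{\max\{r,s\}}$; $\bar r\to\bar s$ if $r\ge s$; $(\bar r\to\bar s)\leftrightarrow\bar s$ if $r<s$; $\neg\neg\bar r$ if $r<1$. The rules are modus ponens and generalization (from $\varphi$ infer $\forall x\,\varphi$). Write $T\vdash\varphi$ if $\varphi$ is derivable from the axioms and the sentences of $T$. A theory $T$ is strongly consistent if $T\nvdash\bar r$ for every rational $r\in(0,1]$. Theorem (completeness of $RGL^*$). Every strongly consistent $\mathcal{L}$-theory has a model. -/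

import Mathlib

/-! First-order rational Goedel logic: syntax, proof system, and semantics in
`[0,1]² \ {(0,r) : r > 0}` with the lexicographic order. Here `0` is truth and `1` is falsity. -/

universe u v w

namespace RGL


/-! ### Truth values -/

/-- The set `[0,1]² \ {(0,r) : r > 0}`. -/
@[ext] structure TruthValue : Type where
  /-- the first coordinate -/
  fst : ℝ
  /-- the second coordinate -/
  snd : ℝ
  fst_mem : fst ∈ Set.Icc (0 : ℝ) 1
  snd_mem : snd ∈ Set.Icc (0 : ℝ) 1
  not_zero_pos : ¬ (fst = 0 ∧ 0 < snd)

/-- Truth values are ordered lexicographically. -/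
noncomputable instance : LinearOrder TruthValue :=
  LinearOrder.lift' (fun p => toLex (p.fst, p.snd)) fun p q h => by
    have h' : (p.fst, p.snd) = (q.fst, q.snd) := toLex.injective h
    exact TruthValue.ext (congrArg Prod.fst h') (congrArg Prod.snd h')

/-- The rationals in `[0,1]`. -/
abbrev UnitRat : Type := Set.Icc (0 : ℚ) 1

namespace TruthValue

/-- The truth value `(r, r)`, for a rational `r` in `[0,1]`. -/
def diag (r : UnitRat) : TruthValue where
  fst := (r.1 : ℝ)
  snd := (r.1 : ℝ)
  fst_mem := ⟨by exact_mod_cast r.2.1, by exact_mod_cast r.2.2⟩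
  snd_mem := ⟨by exact_mod_cast r.2.1, by exact_mod_cast r.2.2⟩
  not_zero_pos := fun h => h.2.ne' h.1

theorem le_iff (p q : TruthValue) :
    p ≤ q ↔ p.fst < q.fst ∨ (p.fst = q.fst ∧ p.snd ≤ q.snd) :=
  Prod.Lex.le_iff

/-- The order of truth values is complete. -/
theorem exists_isLUB (S : Set TruthValue) : ∃ a, IsLUB S a := by
  set A : Set ℝ := {x | ∃ p ∈ S, p.fst = x} with hA
  set B : Set ℝ := {y | ∃ p ∈ S, p.fst = sSup A ∧ p.snd = y} with hB
  have hA1 : ∀ x ∈ A, x ≤ 1 := by rintro x ⟨p, -, rfl⟩; exact p.fst_mem.2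
  have hA0 : ∀ x ∈ A, 0 ≤ x := by rintro x ⟨p, -, rfl⟩; exact p.fst_mem.1
  have hB1 : ∀ x ∈ B, x ≤ 1 := by rintro x ⟨p, -, -, rfl⟩; exact p.snd_mem.2
  have hB0 : ∀ x ∈ B, 0 ≤ x := by rintro x ⟨p, -, -, rfl⟩; exact p.snd_mem.1
  have hz : ¬ (sSup A = 0 ∧ 0 < sSup B) := by
    rintro ⟨h0, hpos⟩
    refine absurd (Real.sSup_le ?_ le_rfl : sSup B ≤ 0) (not_le.2 hpos)
    rintro y ⟨p, -, hp, rfl⟩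
    exact not_lt.1 fun h => p.not_zero_pos ⟨hp.trans h0, h⟩
  refine ⟨⟨sSup A, sSup B, ⟨Real.sSup_nonneg hA0, Real.sSup_le hA1 zero_le_one⟩,
    ⟨Real.sSup_nonneg hB0, Real.sSup_le hB1 zero_le_one⟩, hz⟩, ?_, ?_⟩
  · intro p hp
    rw [le_iff]
    have h : p.fst ≤ sSup A := le_csSup ⟨1, hA1⟩ ⟨p, hp, rfl⟩
    rcases h.lt_or_eq with h | h
    · exact Or.inl h
    · exact Or.inr ⟨h, le_csSup ⟨1, hB1⟩ ⟨p, hp, h, rfl⟩⟩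
  · intro q hq
    rw [le_iff]
    have h : sSup A ≤ q.fst := by
      refine Real.sSup_le ?_ q.fst_mem.1
      rintro x ⟨p, hp, rfl⟩
      rcases (le_iff p q).1 (hq hp) with h | h
      · exact h.le
      · exact h.1.le
    rcases h.lt_or_eq with h | h
    · exact Or.inl h
    · refine Or.inr ⟨h, Real.sSup_le ?_ q.snd_mem.1⟩
      rintro y ⟨p, hp, hpA, rfl⟩
      rcases (le_iff p q).1 (hq hp) with h' | h'
      · exact absurd (hpA.trans h) h'.ne
      · exact h'.2

theorem exists_isGLB (S : Set TruthValue) : ∃ a, IsGLB S a :=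
  (exists_isLUB (lowerBounds S)).imp fun _ h => isLUB_lowerBounds.1 h

/-- The least upper bound of a set of truth values. -/
noncomputable def sup (S : Set TruthValue) : TruthValue := (exists_isLUB S).choose

/-- The greatest lower bound of a set of truth values. -/
noncomputable def inf (S : Set TruthValue) : TruthValue := (exists_isGLB S).choose

theorem isLUB_sup (S : Set TruthValue) : IsLUB S (sup S) := (exists_isLUB S).choose_spec

theorem isGLB_inf (S : Set TruthValue) : IsGLB S (inf S) := (exists_isGLB S).choose_spec

/-- The interpretation of implication. -/
noncomputable def imp (p q : TruthValue) : TruthValue := if q ≤ p then diag 0 else q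

end TruthValue

/-! ### Formulas -/

/-- Formulas over the language `L`, with variables indexed by `ℕ`. The nullary connectives are
the `const r`; constant symbols of `L` are the function symbols of arity `0`. -/
inductive Formula (L : FirstOrder.Language.{u, v}) : Type (max u v)
  | const (r : UnitRat) : Formula L
  | rel {n : ℕ} (R : L.Relations n) (ts : Fin n → L.Term ℕ) : Formula L
  | and (φ ψ : Formula L) : Formula L
  | imp (φ ψ : Formula L) : Formula L
  | all (x : ℕ) (φ : Formula L) : Formula L
  | ex (x : ℕ) (φ : Formula L) : Formula L

/-- Substitution of the term `s` for the variable `x` in a term. -/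
def substTerm {L : FirstOrder.Language.{u, v}} (x : ℕ) (s t : L.Term ℕ) : L.Term ℕ :=
  t.subst fun y => if y = x then s else FirstOrder.Language.Term.var y

namespace Formula

variable {L : FirstOrder.Language.{u, v}}

/-- Negation, `φ → 1`. -/
def neg (φ : Formula L) : Formula L := imp φ (const 1)

/-- Disjunction, `((φ → ψ) → ψ) ∧ ((ψ → φ) → φ)`. -/
def or (φ ψ : Formula L) : Formula L := and (imp (imp φ ψ) ψ) (imp (imp ψ φ) φ)

/-- Equivalence, `(φ → ψ) ∧ (ψ → φ)`. -/
def iff (φ ψ : Formula L) : Formula L := and (imp φ ψ) (imp ψ φ)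

/-- The free variables of a formula. -/
def freeVars : Formula L → Finset ℕ
  | const _ => ∅
  | rel _ ts => Finset.univ.biUnion fun i => (ts i).varFinset
  | and φ ψ => φ.freeVars ∪ ψ.freeVars
  | imp φ ψ => φ.freeVars ∪ ψ.freeVars
  | all x φ => φ.freeVars.erase x
  | ex x φ => φ.freeVars.erase x

/-- Replacement of the free occurrences of the variable `x` by the term `t`. -/
def subst (x : ℕ) (t : L.Term ℕ) : Formula L → Formula L
  | const r => const r
  | rel R ts => rel R fun i => substTerm x t (ts i)
  | and φ ψ => and (subst x t φ) (subst x t ψ)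
  | imp φ ψ => imp (subst x t φ) (subst x t ψ)
  | all y φ => if y = x then all y φ else all y (subst x t φ)
  | ex y φ => if y = x then ex y φ else ex y (subst x t φ)

/-- The term `t` is substitutable for the variable `x`: no variable of `t` becomes bound when `t`
replaces a free occurrence of `x`. -/
def Substitutable (x : ℕ) (t : L.Term ℕ) : Formula L → Prop
  | const _ => True
  | rel _ _ => True
  | and φ ψ => Substitutable x t φ ∧ Substitutable x t ψ
  | imp φ ψ => Substitutable x t φ ∧ Substitutable x t ψ
  | all y φ => x ∉ (all y φ).freeVars ∨ (y ∉ t.varFinset ∧ Substitutable x t φ)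
  | ex y φ => x ∉ (ex y φ).freeVars ∨ (y ∉ t.varFinset ∧ Substitutable x t φ)

end Formula

/-- Sentences: formulas without free variables. -/
def Sentence (L : FirstOrder.Language.{u, v}) : Type (max u v) := {φ : Formula L // φ.freeVars = ∅}

/-- Theories: arbitrary sets of sentences. -/
abbrev Theory (L : FirstOrder.Language.{u, v}) : Type (max u v) := Set (Sentence L)

/-! ### The proof system -/

open Formula in
/-- The axioms of first-order rational Goedel logic. -/
inductive Ax {L : FirstOrder.Language.{u, v}} : Formula L → Prop
  | g1 (φ ψ χ : Formula L) : Ax (imp (imp φ ψ) (imp (imp ψ χ) (imp φ χ)))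
  | g2 (φ ψ : Formula L) : Ax (imp (and φ ψ) φ)
  | g3 (φ ψ : Formula L) : Ax (imp (and φ ψ) (and ψ φ))
  | g4 (φ : Formula L) : Ax (imp φ (and φ φ))
  | g5 (φ ψ χ : Formula L) : Ax (iff (imp φ (imp ψ χ)) (imp (and φ ψ) χ))
  | g6 (φ ψ χ : Formula L) :
      Ax (imp (imp (imp φ ψ) χ) (imp (imp (imp ψ φ) χ) χ))
  | g7 (φ : Formula L) : Ax (imp (const 1) φ)
  | all1 (x : ℕ) (t : L.Term ℕ) (φ : Formula L) (h : φ.Substitutable x t) :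
      Ax (imp (all x φ) (φ.subst x t))
  | all2 (x : ℕ) (ψ φ : Formula L) (h : x ∉ ψ.freeVars) :
      Ax (imp (all x (imp ψ φ)) (imp ψ (all x φ)))
  | all3 (x : ℕ) (ψ φ : Formula L) (h : x ∉ ψ.freeVars) :
      Ax (imp (all x (or ψ φ)) (or ψ (all x φ)))
  | ex1 (x : ℕ) (t : L.Term ℕ) (φ : Formula L) (h : φ.Substitutable x t) :
      Ax (imp (φ.subst x t) (ex x φ))
  | ex2 (x : ℕ) (φ ψ : Formula L) (h : x ∉ ψ.freeVars) :
      Ax (imp (all x (imp φ ψ)) (imp (ex x φ) ψ))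
  | rgl1 (r s : UnitRat) : Ax (iff (and (const r) (const s)) (const (max r s)))
  | rgl2_of_ge (r s : UnitRat) (h : s ≤ r) : Ax (imp (const r) (const s))
  | rgl2_of_lt (r s : UnitRat) (h : r < s) :
      Ax (iff (imp (const r) (const s)) (const s))
  | rgl3 (r : UnitRat) (h : r < 1) : Ax (neg (neg (const r)))

/-- `Proves T φ`: the formula `φ` has a proof from the axioms and the theory `T` by modus ponens
and generalization. -/
inductive Proves {L : FirstOrder.Language.{u, v}} (T : Theory L) : Formula L → Prop
  | ax {φ : Formula L} (h : Ax φ) : Proves T φ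
  | hyp {φ : Sentence L} (h : φ ∈ T) : Proves T φ.1
  | mp {φ ψ : Formula L} (h : Proves T φ) (h' : Proves T (Formula.imp φ ψ)) : Proves T ψ
  | gen (x : ℕ) {φ : Formula L} (h : Proves T φ) : Proves T (Formula.all x φ)

/-- A theory is strongly consistent if it proves no `r` with `r > 0`. -/
def StronglyConsistent {L : FirstOrder.Language.{u, v}} (T : Theory L) : Prop :=
  ∀ r : UnitRat, 0 < r → ¬ Proves T (Formula.const r)

/-! ### Semantics -/

/-- Structures: a nonempty universe, with predicates valued in `TruthValue`. -/
structure Model (L : FirstOrder.Language.{u, v}) : Type (max u v (w + 1)) where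
  /-- the universe of the structure -/
  carrier : Type w
  nonempty : Nonempty carrier
  /-- the interpretation of the function symbols -/
  funMap : ∀ {n : ℕ}, L.Functions n → (Fin n → carrier) → carrier
  /-- the interpretation of the predicate symbols -/
  relMap : ∀ {n : ℕ}, L.Relations n → (Fin n → carrier) → TruthValue

namespace Model

variable {L : FirstOrder.Language.{u, v}} (M : Model.{u, v, w} L)

/-- The value of a term under an assignment. -/
def termValue (σ : ℕ → M.carrier) : L.Term ℕ → M.carrier
  | FirstOrder.Language.Term.var x => σ x
  | FirstOrder.Language.Term.func f ts => M.funMap f fun i => termValue σ (ts i)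

/-- The truth value of a formula under an assignment. -/
noncomputable def value : (ℕ → M.carrier) → Formula L → TruthValue
  | _, Formula.const r => TruthValue.diag r
  | σ, Formula.rel R ts => M.relMap R fun i => M.termValue σ (ts i)
  | σ, Formula.and φ ψ => max (value σ φ) (value σ ψ)
  | σ, Formula.imp φ ψ => TruthValue.imp (value σ φ) (value σ ψ)
  | σ, Formula.all x φ =>
      TruthValue.sup (Set.range fun a : M.carrier => value (Function.update σ x a) φ)
  | σ, Formula.ex x φ =>
      TruthValue.inf (Set.range fun a : M.carrier => value (Function.update σ x a) φ)

/-- `M` is a model of `T`: every sentence of `T` has the value `(0,0)` in `M`. -/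
def Satisfies (T : Theory L) : Prop :=
  ∀ φ ∈ T, ∀ σ : ℕ → M.carrier, M.value σ φ.1 = TruthValue.diag 0

end Model

/-- A theory is satisfiable if it has a model. -/
def Satisfiable {L : FirstOrder.Language.{u, v}} (T : Theory L) : Prop :=
  ∃ M : Model.{u, v, w} L, M.Satisfies T

end RGL

namespace RGL

/-! ### Continuous embeddings of countable chains -/

/-! A Henkin construction produces a countable chain of truth degrees, which is then embedded into
the lexicographic order. After parameters are added, the provable formulas extend to a prime filter
`Δ` that contains no constant `r > 0` (`exists_saturated`). Modulo equivalence over `Δ`, formulas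
form a countable chain, where larger means falser. The terms over the parameters are the universe of
the model, and atomic formulas take the images of their classes (`termModel`).

Two points differ from the classical argument. First, quantifiers are suprema and infima that need
not be attained. A witness `t` of `∀ x φ` therefore only has to be compared with a given `ψ`: if `∀
x φ` lies strictly above `ψ`, then so does `φ(t)`. Second, a supremum of the chain may be lost in
the lexicographic order: if first coordinates increase strictly to `r`, the supremum is `(r, 0)`. So
every quantified formula also gets a single witness that serves for all constants at once; this
witness has the same standard part as the quantified formula, and only what happens inside that
neighbourhood matters. `mem_of_gen_witness` shows that the resulting infinite family of axioms for
one new parameter is conservative for the constants.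

`exists_truthValue_embedding` maps an element to its standard part and a rescaled position, which
comes from an embedding into the real unit interval that preserves suprema and infima
(`exists_continuous_embedding`). By maximality of `Δ`, every formula outside `Δ` has a positive
constant below it, so only truth has standard part `0`, as the removal of the points `(0, r)`
demands. -/

/-- The points of `C ×ₗ ℚ` that remain when a copy of the non-negative rationals is inserted at each
element having a successor, together with rational end pieces. -/
def Filling (C : Type*) [LinearOrder C] : Type _ :=
  {p : C ×ₗ ℚ // (0 < (ofLex p).2 → IsMax (ofLex p).1 ∨ ∃ b, (ofLex p).1 ⋖ b) ∧
    ((ofLex p).2 < 0 → IsMin (ofLex p).1)}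

namespace Filling

variable {C : Type*} [LinearOrder C]

noncomputable instance : LinearOrder (Filling C) :=
  inferInstanceAs (LinearOrder {_p : C ×ₗ ℚ // _})

instance [Countable C] : Countable (Filling C) :=
  have : Countable (C ×ₗ ℚ) := inferInstanceAs (Countable (C × ℚ))
  inferInstanceAs (Countable {_p : C ×ₗ ℚ // _})

/-- The constructor of `Filling`. -/
def mk (a : C) (q : ℚ) (h : 0 < q → IsMax a ∨ ∃ b, a ⋖ b) (h' : q < 0 → IsMin a) : Filling C :=
  ⟨toLex (a, q), h, h'⟩

/-- The inclusion of a chain into its filling. -/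
def of (a : C) : Filling C :=
  mk a 0 (fun h => absurd h (lt_irrefl _)) fun h => absurd h (lt_irrefl _)

/-- The first coordinate. -/
def base (p : Filling C) : C := (ofLex p.1).1

/-- The second coordinate. -/
def height (p : Filling C) : ℚ := (ofLex p.1).2

theorem isMax_or (p : Filling C) (h : 0 < p.height) : IsMax p.base ∨ ∃ b, p.base ⋖ b := p.2.1 h

theorem isMin (p : Filling C) (h : p.height < 0) : IsMin p.base := p.2.2 h

theorem lt_iff (p q : Filling C) :
    p < q ↔ p.base < q.base ∨ p.base = q.base ∧ p.height < q.height :=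
  Prod.Lex.lt_iff (x := p.1) (y := q.1)

theorem le_iff (p q : Filling C) :
    p ≤ q ↔ p.base < q.base ∨ p.base = q.base ∧ p.height ≤ q.height :=
  Prod.Lex.le_iff (x := p.1) (y := q.1)

@[simp] theorem base_mk (a : C) (q : ℚ) (h h') : (mk a q h h').base = a := rfl

@[simp] theorem height_mk (a : C) (q : ℚ) (h h') : (mk a q h h').height = q := rfl

@[simp] theorem base_of (a : C) : (of a).base = a := rfl

@[simp] theorem height_of (a : C) : (of a).height = 0 := rfl

instance [Nonempty C] : Nonempty (Filling C) := ‹Nonempty C›.map of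

/-- Between two neighbours of `C` lie the positive rationals inserted at the lower one. -/
instance : DenselyOrdered (Filling C) where
  dense p q hpq := by
    rcases (lt_iff p q).1 hpq with h | ⟨h, h'⟩
    · by_cases hc : ∃ c, p.base < c ∧ c < q.base
      · obtain ⟨c, h1, h2⟩ := hc
        exact ⟨of c, (lt_iff _ _).2 (Or.inl h1), (lt_iff _ _).2 (Or.inl h2)⟩
      · have hcov : p.base ⋖ q.base := ⟨h, fun c h1 h2 => hc ⟨c, h1, h2⟩⟩
        have hpos : 0 < max p.height 0 + 1 := by positivity
        refine ⟨mk p.base (max p.height 0 + 1) (fun _ => Or.inr ⟨_, hcov⟩)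
          (fun h => absurd h hpos.not_gt), (lt_iff _ _).2 (Or.inr ⟨rfl, ?_⟩),
          (lt_iff _ _).2 (Or.inl h)⟩
        exact (le_max_left _ _).trans_lt (lt_add_one _)
    · refine ⟨mk p.base ((p.height + q.height) / 2) (fun h0 => ?_) (fun h0 => ?_),
        (lt_iff _ _).2 (Or.inr ⟨rfl, ?_⟩), (lt_iff _ _).2 (Or.inr ⟨h, ?_⟩)⟩
      · rw [h]; exact q.isMax_or (by linarith)
      · exact p.isMin (by linarith)
      · simp only [height_mk]; linarith
      · simp only [height_mk]; linarith

instance : NoMaxOrder (Filling C) where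
  exists_gt p := by
    by_cases h : IsMax p.base
    · have hpos : 0 < max p.height 0 + 1 := by positivity
      refine ⟨mk p.base (max p.height 0 + 1) (fun _ => Or.inl h)
          (fun h => absurd h hpos.not_gt), (lt_iff _ _).2 (Or.inr ⟨rfl, ?_⟩)⟩
      exact (le_max_left _ _).trans_lt (lt_add_one _)
    · obtain ⟨b, hb⟩ := not_isMax_iff.1 h
      exact ⟨of b, (lt_iff _ _).2 (Or.inl hb)⟩

instance : NoMinOrder (Filling C) where
  exists_lt p := by
    by_cases h : IsMin p.base
    · have hneg : min p.height 0 - 1 < 0 := by linarith [min_le_right p.height 0]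
      refine ⟨mk p.base (min p.height 0 - 1) (fun h => absurd h hneg.not_gt) (fun _ => h),
        (lt_iff _ _).2 (Or.inr ⟨rfl, ?_⟩)⟩
      simp only [height_mk]; linarith [min_le_left p.height 0]
    · obtain ⟨b, hb⟩ := not_isMin_iff.1 h
      exact ⟨of b, (lt_iff _ _).2 (Or.inl hb)⟩

theorem of_le_of {a b : C} : of a ≤ of b ↔ a ≤ b := by
  rw [le_iff, le_iff_lt_or_eq (a := a)]; simp

theorem strictMono_of : StrictMono (of : C → Filling C) :=
  fun _ _ h => (lt_iff _ _).2 (Or.inl h)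

/-- A point over `e` but below `of e` exists only if `e` is minimal, and then `S = {e}`. -/
theorem isLUB_of {S : Set C} {e : C} (h : IsLUB S e) (hS : S.Nonempty) :
    IsLUB (of '' S) (of e) := by
  refine ⟨?_, fun p hp => ?_⟩
  · rintro _ ⟨s, hs, rfl⟩; exact of_le_of.2 (h.1 hs)
  · have hle : e ≤ p.base := h.2 fun s hs => by
      rcases (le_iff _ _).1 (hp ⟨s, hs, rfl⟩) with h | h
      · exact h.le
      · exact h.1.le
    rcases hle.lt_or_eq with hlt | heq
    · exact (le_iff _ _).2 (Or.inl hlt)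
    · by_cases hneg : p.height < 0
      · obtain ⟨s, hs⟩ := hS
        have : s = e := le_antisymm (h.1 hs) (heq ▸ p.isMin hneg (heq ▸ h.1 hs))
        exact this ▸ hp ⟨s, hs, rfl⟩
      · exact (le_iff _ _).2 (Or.inr ⟨heq, not_lt.1 hneg⟩)

/-- An infimum `e` outside `S` is not maximal and has no successor, since a successor would be a
larger lower bound. So nothing was inserted directly above `e`. -/
theorem isGLB_of {S : Set C} {e : C} (h : IsGLB S e) (hS : S.Nonempty) :
    IsGLB (of '' S) (of e) := by
  refine ⟨?_, fun p hp => ?_⟩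
  · rintro _ ⟨s, hs, rfl⟩; exact of_le_of.2 (h.1 hs)
  · have hle : p.base ≤ e := h.2 fun s hs => by
      rcases (le_iff _ _).1 (hp ⟨s, hs, rfl⟩) with h | h
      · exact h.le
      · exact h.1.le
    rcases hle.lt_or_eq with hlt | heq
    · exact (le_iff _ _).2 (Or.inl hlt)
    · by_cases hpos : 0 < p.height
      · by_cases heS : e ∈ S
        · exact hp ⟨e, heS, rfl⟩
        exfalso
        rcases p.isMax_or hpos with hm | ⟨b, hb⟩
        · obtain ⟨s, hs⟩ := hS
          have : s = e := le_antisymm (heq ▸ hm (heq ▸ h.1 hs)) (h.1 hs)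
          exact heS (this ▸ hs)
        · rw [heq] at hb
          refine (hb.lt.trans_le (h.2 fun s hs => ?_)).false
          exact hb.ge_of_gt (lt_of_le_of_ne (h.1 hs) fun h => heS (h ▸ hs))
      · exact (le_iff _ _).2 (Or.inr ⟨heq, not_lt.1 hpos⟩)

end Filling

/-- A real upper bound below `e` would leave room for a rational one; an element of `S` keeps that
rational positive. -/
theorem isLUB_image_ratCast {S : Set (Set.Ioo (0 : ℚ) 1)} {e : Set.Ioo (0 : ℚ) 1}
    (h : IsLUB S e) (hS : S.Nonempty) :
    IsLUB ((fun q : Set.Ioo (0 : ℚ) 1 => ((q : ℚ) : ℝ)) '' S) ((e : ℚ) : ℝ) := by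
  refine ⟨?_, fun b hb => ?_⟩
  · rintro _ ⟨s, hs, rfl⟩; exact Rat.cast_le.2 (h.1 hs)
  · by_contra hlt
    obtain ⟨q, h1, h2⟩ := exists_rat_btwn (not_le.1 hlt)
    have hq2 : q < e := by exact_mod_cast h2
    have hle : ∀ s ∈ S, (s : ℚ) ≤ q := fun s hs => by
      have : ((s : ℚ) : ℝ) ≤ q := (hb ⟨s, hs, rfl⟩).trans h1.le
      exact_mod_cast this
    obtain ⟨s, hs⟩ := hS
    have hq : q ∈ Set.Ioo (0 : ℚ) 1 := ⟨s.2.1.trans_le (hle s hs), hq2.trans e.2.2⟩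
    exact hq2.not_ge (h.2 (show (⟨q, hq⟩ : Set.Ioo (0 : ℚ) 1) ∈ upperBounds S from hle))

theorem isGLB_image_ratCast {S : Set (Set.Ioo (0 : ℚ) 1)} {e : Set.Ioo (0 : ℚ) 1}
    (h : IsGLB S e) (hS : S.Nonempty) :
    IsGLB ((fun q : Set.Ioo (0 : ℚ) 1 => ((q : ℚ) : ℝ)) '' S) ((e : ℚ) : ℝ) := by
  refine ⟨?_, fun b hb => ?_⟩
  · rintro _ ⟨s, hs, rfl⟩; exact Rat.cast_le.2 (h.1 hs)
  · by_contra hlt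
    obtain ⟨q, h1, h2⟩ := exists_rat_btwn (not_le.1 hlt)
    have hq2 : e < q := by exact_mod_cast h1
    have hle : ∀ s ∈ S, q ≤ (s : ℚ) := fun s hs => by
      have : (q : ℝ) ≤ ((s : ℚ) : ℝ) := h2.le.trans (hb ⟨s, hs, rfl⟩)
      exact_mod_cast this
    obtain ⟨s, hs⟩ := hS
    have hq : q ∈ Set.Ioo (0 : ℚ) 1 := ⟨e.2.1.trans hq2, (hle s hs).trans_lt s.2.2⟩
    exact hq2.not_ge (h.2 (show (⟨q, hq⟩ : Set.Ioo (0 : ℚ) 1) ∈ lowerBounds S from hle))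

/-- A countable chain embeds into the open unit interval with all its suprema and infima. -/
theorem exists_continuous_embedding (C : Type*) [LinearOrder C] [Countable C] [Nonempty C] :
    ∃ f : C → ℝ, StrictMono f ∧ (∀ a, 0 < f a ∧ f a < 1) ∧
      (∀ S e, IsLUB S e → S.Nonempty → IsLUB (f '' S) (f e)) ∧
      ∀ S e, IsGLB S e → S.Nonempty → IsGLB (f '' S) (f e) := by
  have : Nonempty (Set.Ioo (0 : ℚ) 1) := ⟨⟨1 / 2, by norm_num, by norm_num⟩⟩
  -- Cantor's theorem: the filling is countable, dense and without endpoints.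
  obtain ⟨i⟩ := Order.iso_of_countable_dense (Filling C) (Set.Ioo (0 : ℚ) 1)
  refine ⟨fun a => ((i (Filling.of a) : ℚ) : ℝ), fun a b h => ?_, fun a => ⟨?_, ?_⟩,
    fun S e h hS => ?_, fun S e h hS => ?_⟩
  · exact Rat.cast_lt.2 (i.strictMono (Filling.strictMono_of h))
  · exact Rat.cast_pos.2 (i (Filling.of a)).2.1
  · exact (Rat.cast_lt.2 (i (Filling.of a)).2.2).trans_eq Rat.cast_one
  · have := isLUB_image_ratCast (i.isLUB_image'.2 (Filling.isLUB_of h hS)) ((hS.image _).image _)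
    simpa only [Set.image_image] using this
  · have := isGLB_image_ratCast (i.isGLB_image'.2 (Filling.isGLB_of h hS)) ((hS.image _).image _)
    simpa only [Set.image_image] using this

/-! ### Embedding of chains with rational constants into the truth values -/

/-- The piecewise linear map with `0 ↦ 0`, `p ↦ q` and `1 ↦ 1`. -/
noncomputable def bend (p q x : ℝ) : ℝ := q * (min x p / p) + (1 - q) * (max (x - p) 0 / (1 - p))

theorem continuous_bend (p q : ℝ) : Continuous (bend p q) := by
  unfold bend; fun_prop

theorem bend_self {p q : ℝ} (hp : 0 < p) : bend p q p = q := by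
  simp [bend, hp.ne']

theorem bend_mem {p q x : ℝ} (hp : 0 < p) (hp' : p < 1) (hq : 0 ≤ q) (hq' : q ≤ 1) (hx : 0 ≤ x)
    (hx' : x ≤ 1) : bend p q x ∈ Set.Icc (0 : ℝ) 1 := by
  have h1 : 0 ≤ min x p / p := div_nonneg (le_min hx hp.le) hp.le
  have h2 : 0 ≤ max (x - p) 0 / (1 - p) := div_nonneg (le_max_right _ _) (by linarith)
  have h3 : min x p / p ≤ 1 := (div_le_one hp).2 (min_le_right _ _)
  have h4 : max (x - p) 0 / (1 - p) ≤ 1 :=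
    (div_le_one (by linarith)).2 (max_le (by linarith) (by linarith))
  unfold bend
  constructor
  · have := mul_nonneg hq h1
    have := mul_nonneg (sub_nonneg.2 hq') h2
    linarith
  · have := mul_le_mul_of_nonneg_left h3 hq
    have := mul_le_mul_of_nonneg_left h4 (sub_nonneg.2 hq')
    linarith

/-- The map is flat on `[0, p]` if `q = 0` and on `[p, 1]` if `q = 1`; the last two hypotheses put
both points on the other side of `p` in these cases. -/
theorem bend_lt_bend {p q x y : ℝ} (hp : 0 < p) (hp' : p < 1) (hq : 0 ≤ q) (hq' : q ≤ 1)
    (hxy : x < y) (h0 : 0 < q ∨ p ≤ x) (h1 : q < 1 ∨ y ≤ p) : bend p q x < bend p q y := by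
  have a1 : min x p / p ≤ min y p / p := by gcongr
  have a2 : max (x - p) 0 / (1 - p) ≤ max (y - p) 0 / (1 - p) := by
    have : 0 < 1 - p := by linarith
    gcongr
  have b1 := mul_le_mul_of_nonneg_left a1 hq
  have b2 := mul_le_mul_of_nonneg_left a2 (sub_nonneg.2 hq')
  unfold bend
  rcases lt_or_ge x p with hx | hx
  · have hq0 : 0 < q := h0.resolve_right (not_le.2 hx)
    have : min x p / p < min y p / p := by
      apply div_lt_div_of_pos_right _ hp
      rw [min_eq_left hx.le]; exact lt_min hxy hx
    have := mul_lt_mul_of_pos_left this hq0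
    linarith
  · have hq1 : q < 1 := h1.resolve_right (not_le.2 (hx.trans_lt hxy))
    have : max (x - p) 0 / (1 - p) < max (y - p) 0 / (1 - p) := by
      apply div_lt_div_of_pos_right _ (by linarith)
      rw [max_eq_left (by linarith), max_eq_left (by linarith)]; linarith
    have := mul_lt_mul_of_pos_left this (sub_pos.2 hq1)
    linarith

section

variable {C : Type*} {κ : UnitRat → C}

open Classical in
/-- The rescaling of the unit interval used on the elements with standard part `x`. -/
noncomputable def rescale (κ : UnitRat → C) (f : C → ℝ) (x : ℝ) : ℝ → ℝ :=
  -- At a rational `x = r` the position of `κ r` is moved to `r`, so that `κ r` lands on `(r, r)`.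
  -- At other `x` there is no constant to place.
  if h : ∃ r : UnitRat, ((r : ℚ) : ℝ) = x then bend (f (κ h.choose)) x else id

theorem rescale_unitRat (f : C → ℝ) (r : UnitRat) :
    rescale κ f ((r : ℚ) : ℝ) = bend (f (κ r)) ((r : ℚ) : ℝ) := by
  have h : ∃ s : UnitRat, ((s : ℚ) : ℝ) = ((r : ℚ) : ℝ) := ⟨r, rfl⟩
  have hs : h.choose = r := Subtype.ext (by exact_mod_cast h.choose_spec)
  unfold rescale
  rw [dif_pos h, hs]

theorem continuous_rescale (f : C → ℝ) (x : ℝ) : Continuous (rescale κ f x) := by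
  unfold rescale
  split_ifs
  · exact continuous_bend _ _
  · exact continuous_id

theorem rescale_mem {f : C → ℝ} (hf : ∀ a, 0 < f a ∧ f a < 1) (x : ℝ) (a : C) :
    rescale κ f x (f a) ∈ Set.Icc (0 : ℝ) 1 := by
  unfold rescale
  split_ifs with h
  · obtain ⟨h0, h1⟩ := h.choose.2
    refine bend_mem (hf _).1 (hf _).2 ?_ ?_ (hf a).1.le (hf a).2.le
    · rw [← h.choose_spec]; exact_mod_cast h0
    · rw [← h.choose_spec]; exact_mod_cast h1
  · exact ⟨(hf a).1.le, (hf a).2.le⟩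

variable (κ) [LinearOrder C]

/-- The standard part of an element of a chain with rational constants. -/
noncomputable def stdPart (a : C) : ℝ := sSup {x : ℝ | ∃ r : UnitRat, κ r ≤ a ∧ ((r : ℚ) : ℝ) = x}

variable {κ}

theorem stdPart_bddAbove (a : C) :
    BddAbove {x : ℝ | ∃ r : UnitRat, κ r ≤ a ∧ ((r : ℚ) : ℝ) = x} := by
  refine ⟨1, ?_⟩
  rintro _ ⟨r, -, rfl⟩
  exact_mod_cast r.2.2

theorem le_stdPart {a : C} {r : UnitRat} (h : κ r ≤ a) : ((r : ℚ) : ℝ) ≤ stdPart κ a :=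
  le_csSup (stdPart_bddAbove a) ⟨r, h, rfl⟩

theorem stdPart_nonneg (a : C) : 0 ≤ stdPart κ a :=
  Real.sSup_nonneg (by rintro _ ⟨r, -, rfl⟩; exact_mod_cast r.2.1)

theorem stdPart_le {a : C} {r : UnitRat} (hκ : StrictMono κ) (h : a ≤ κ r) :
    stdPart κ a ≤ ((r : ℚ) : ℝ) := by
  refine Real.sSup_le ?_ (by exact_mod_cast r.2.1)
  rintro _ ⟨s, hs, rfl⟩
  exact_mod_cast hκ.le_iff_le.1 (hs.trans h)

theorem stdPart_const (hκ : StrictMono κ) (r : UnitRat) : stdPart κ (κ r) = ((r : ℚ) : ℝ) :=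
  le_antisymm (stdPart_le hκ le_rfl) (le_stdPart le_rfl)

theorem stdPart_mono {a b : C} (h : a ≤ b) : stdPart κ a ≤ stdPart κ b := by
  refine Real.sSup_le ?_ (stdPart_nonneg b)
  rintro _ ⟨r, hr, rfl⟩
  exact le_stdPart (hr.trans h)

theorem stdPart_le_one (a : C) : stdPart κ a ≤ 1 :=
  Real.sSup_le (by rintro _ ⟨r, -, rfl⟩; exact_mod_cast r.2.2) zero_le_one

theorem lt_of_lt_stdPart {a : C} {r : UnitRat} (hκ : StrictMono κ)
    (h : ((r : ℚ) : ℝ) < stdPart κ a) : κ r < a := by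
  by_contra hle
  exact absurd (stdPart_le hκ (not_lt.1 hle)) (not_le.2 h)

/-- A rational of the unit interval between two reals of the unit interval. -/
theorem exists_unitRat_btwn {x y : ℝ} (hx : 0 ≤ x) (hy : y ≤ 1) (h : x < y) :
    ∃ r : UnitRat, x < ((r : ℚ) : ℝ) ∧ ((r : ℚ) : ℝ) < y := by
  obtain ⟨q, h1, h2⟩ := exists_rat_btwn h
  refine ⟨⟨q, ?_, ?_⟩, h1, h2⟩
  · exact_mod_cast (hx.trans_lt h1).le
  · exact_mod_cast (h2.trans_le hy).le

/-- A countable chain with rational constants embeds into the truth values, so that the constants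
go to the diagonal, and the suprema and infima which are approached within their infinitesimal
neighbourhood are preserved. -/
theorem exists_truthValue_embedding [Countable C] (hκ : StrictMono κ) (hbot : ∀ a, κ 0 ≤ a)
    (htop : ∀ a, a ≤ κ 1) (harch : ∀ a, κ 0 < a → ∃ r : UnitRat, 0 < r ∧ κ r ≤ a) :
    ∃ h : C → TruthValue, StrictMono h ∧ (∀ r, h (κ r) = TruthValue.diag r) ∧
      (∀ S e, IsLUB S e → (∃ a ∈ S, ∀ r, κ r < e → κ r < a) → IsLUB (h '' S) (h e)) ∧
      ∀ S e, IsGLB S e → (∃ a ∈ S, ∀ r, e < κ r → a < κ r) → IsGLB (h '' S) (h e) := by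
  have : Nonempty C := ⟨κ 0⟩
  obtain ⟨f, hf, hf01, hlub, hglb⟩ := exists_continuous_embedding C
  -- The Archimedean hypothesis leaves only `κ 0` with standard part zero, which keeps the image off
  -- the removed points.
  have hzero : ∀ a, stdPart κ a = 0 → a = κ 0 := fun a ha => by
    by_contra hne
    obtain ⟨r, hr, hra⟩ := harch a (lt_of_le_of_ne (hbot a) (Ne.symm hne))
    have := le_stdPart hra
    rw [ha] at this
    exact hr.not_ge (by exact_mod_cast this)
  have hcst : ∀ r : UnitRat, rescale κ f ((r : ℚ) : ℝ) (f (κ r)) = ((r : ℚ) : ℝ) := fun r => by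
    rw [rescale_unitRat, bend_self (hf01 _).1]
  have hstrict : ∀ a b, a < b → stdPart κ a = stdPart κ b →
      rescale κ f (stdPart κ a) (f a) < rescale κ f (stdPart κ a) (f b) := fun a b hab hst => by
    by_cases hr : ∃ r : UnitRat, ((r : ℚ) : ℝ) = stdPart κ a
    · obtain ⟨r, hr⟩ := hr
      rw [← hr, rescale_unitRat]
      refine bend_lt_bend (hf01 _).1 (hf01 _).2 (by exact_mod_cast r.2.1)
        (by exact_mod_cast r.2.2) (hf hab) ?_ ?_
      · rcases r.2.1.lt_or_eq with h | h
        · exact Or.inl (by exact_mod_cast h)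
        · right
          have h0 : r = 0 := Subtype.ext h.symm
          rw [h0]; exact hf.monotone (hbot a)
      · rcases r.2.2.lt_or_eq with h | h
        · exact Or.inl (by exact_mod_cast h)
        · right
          have h0 : r = 1 := Subtype.ext h
          rw [h0]; exact hf.monotone (htop b)
    · unfold rescale
      rw [dif_neg hr]; exact hf hab
  refine ⟨fun a => ⟨stdPart κ a, rescale κ f (stdPart κ a) (f a),
    ⟨stdPart_nonneg a, stdPart_le_one a⟩, rescale_mem hf01 _ _, ?_⟩, ?_, ?_, ?_, ?_⟩
  · rintro ⟨h0, h1⟩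
    have h2 := hcst 0
    have h3 : ((((0 : UnitRat) : ℚ)) : ℝ) = 0 := by simp
    rw [h3] at h2
    rw [h0, hzero a h0, h2] at h1
    exact h1.false
  · refine fun a b hab => lt_of_not_ge fun hle => ?_
    rcases (TruthValue.le_iff _ _).1 hle with h | ⟨h, h'⟩
    · exact absurd (stdPart_mono hab.le) (not_le.2 h)
    · dsimp only at h h'
      rw [h] at h'
      exact absurd (hstrict a b hab h.symm) (not_lt.2 h')
  · intro r
    ext
    · exact stdPart_const hκ r
    · change rescale κ f (stdPart κ (κ r)) (f (κ r)) = _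
      rw [stdPart_const hκ r]
      exact hcst r
  · rintro S e he ⟨a₀, ha₀, hwit⟩
    -- A rational between the two standard parts would give a constant below `e` but not below `a₀`.
    have hst : ∀ a, a₀ ≤ a → a ≤ e → stdPart κ a = stdPart κ e := fun a h1 h2 => by
      refine le_antisymm (stdPart_mono h2) (le_of_not_gt fun hlt => ?_)
      obtain ⟨r, hr1, hr2⟩ := exists_unitRat_btwn (stdPart_nonneg a) (stdPart_le_one e) hlt
      exact absurd (le_stdPart ((hwit r (lt_of_lt_stdPart hκ hr2)).le.trans h1)) (not_le.2 hr1)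
    have he' : IsLUB (S ∩ Set.Ici a₀) e := by
      refine ⟨fun a ha => he.1 ha.1, fun b hb => he.2 fun a ha => ?_⟩
      rcases le_total a₀ a with h | h
      · exact hb ⟨ha, h⟩
      · exact h.trans (hb ⟨ha₀, le_rfl⟩)
    have hcl := (hlub _ e he' ⟨a₀, ha₀, le_rfl⟩).mem_closure (Set.Nonempty.image _ ⟨a₀, ha₀, le_rfl⟩)
    refine ⟨?_, fun b hb => ?_⟩
    · rintro _ ⟨a, ha, rfl⟩
      rw [TruthValue.le_iff]
      rcases (stdPart_mono (κ := κ) (he.1 ha)).lt_or_eq with h | h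
      · exact Or.inl h
      · refine Or.inr ⟨h, ?_⟩
        rcases (he.1 ha).lt_or_eq with h' | h'
        · have := (hstrict a e h' h).le
          dsimp only
          rwa [h] at this ⊢
        · rw [h']
    · rw [TruthValue.le_iff]
      have hb₀ := (TruthValue.le_iff _ _).1 (hb ⟨a₀, ha₀, rfl⟩)
      dsimp only at hb₀ ⊢
      rw [hst a₀ le_rfl (he.1 ha₀)] at hb₀
      rcases hb₀ with h | ⟨h, -⟩
      · exact Or.inl h
      · refine Or.inr ⟨h, ?_⟩
        -- First coordinates are constant between `a₀` and `e`, so `b.snd` bounds the second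
        -- coordinates there; by continuity the bound passes to the limit point `e`.
        have := map_mem_closure (t := Set.Iic b.snd) (continuous_rescale (κ := κ) f (stdPart κ e)) hcl ?_
        · rwa [isClosed_Iic.closure_eq] at this
        · rintro _ ⟨a, ⟨ha, ha'⟩, rfl⟩
          have h1 := (TruthValue.le_iff _ _).1 (hb ⟨a, ha, rfl⟩)
          dsimp only at h1
          rw [hst a ha' (he.1 ha)] at h1
          rcases h1 with h1 | h1
          · exact absurd h h1.ne
          · exact h1.2
  · rintro S e he ⟨a₀, ha₀, hwit⟩
    have hst : ∀ a, a ≤ a₀ → e ≤ a → stdPart κ a = stdPart κ e := fun a h1 h2 => by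
      refine le_antisymm (le_of_not_gt fun hlt => ?_) (stdPart_mono h2)
      obtain ⟨r, hr1, hr2⟩ := exists_unitRat_btwn (stdPart_nonneg e) (stdPart_le_one a) hlt
      refine absurd (stdPart_le hκ (h1.trans (hwit r ?_).le)) (not_le.2 hr2)
      by_contra hle
      exact absurd (le_stdPart (not_lt.1 hle)) (not_le.2 hr1)
    have he' : IsGLB (S ∩ Set.Iic a₀) e := by
      refine ⟨fun a ha => he.1 ha.1, fun b hb => he.2 fun a ha => ?_⟩
      rcases le_total a a₀ with h | h
      · exact hb ⟨ha, h⟩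
      · exact (hb ⟨ha₀, le_rfl⟩ : b ≤ a₀).trans h
    have hcl := (hglb _ e he' ⟨a₀, ha₀, le_rfl⟩).mem_closure (Set.Nonempty.image _ ⟨a₀, ha₀, le_rfl⟩)
    refine ⟨?_, fun b hb => ?_⟩
    · rintro _ ⟨a, ha, rfl⟩
      rw [TruthValue.le_iff]
      rcases (stdPart_mono (κ := κ) (he.1 ha)).lt_or_eq with h | h
      · exact Or.inl h
      · refine Or.inr ⟨h, ?_⟩
        rcases (he.1 ha).lt_or_eq with h' | h'
        · have := (hstrict e a h' h).le
          dsimp only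
          rwa [← h]
        · rw [h']
    · rw [TruthValue.le_iff]
      have hb₀ := (TruthValue.le_iff _ _).1 (hb ⟨a₀, ha₀, rfl⟩)
      dsimp only at hb₀ ⊢
      rw [hst a₀ le_rfl (he.1 ha₀)] at hb₀
      rcases hb₀ with h | ⟨h, -⟩
      · exact Or.inl h
      · refine Or.inr ⟨h, ?_⟩
        have := map_mem_closure (t := Set.Ici b.snd) (continuous_rescale (κ := κ) f (stdPart κ e)) hcl ?_
        · rwa [isClosed_Ici.closure_eq] at this
        · rintro _ ⟨a, ⟨ha, ha'⟩, rfl⟩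
          have h1 := (TruthValue.le_iff _ _).1 (hb ⟨a, ha, rfl⟩)
          dsimp only at h1
          rw [hst a ha' (he.1 ha)] at h1
          rcases h1 with h1 | h1
          · exact absurd h h1.ne
          · exact h1.2

end

end RGL

namespace RGL

/-! ### Deductively closed sets of formulas -/

/-- The propositional connectives on a set of formulas. -/
structure Signature (F : Type*) where
  /-- implication -/
  imp : F → F → F
  /-- conjunction -/
  and : F → F → F
  /-- the nullary connectives -/
  const : UnitRat → F

namespace Signature

variable {F : Type*} (K : Signature F)

/-- Disjunction, as an abbreviation. -/
def or (a b : F) : F := K.and (K.imp (K.imp a b) b) (K.imp (K.imp b a) a)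

/-- Equivalence, as an abbreviation. -/
def iff (a b : F) : F := K.and (K.imp a b) (K.imp b a)

/-- Sets of formulas containing the propositional axioms and closed under modus ponens. -/
structure IsFilter (Δ : Set F) : Prop where
  g1 (a b c : F) : K.imp (K.imp a b) (K.imp (K.imp b c) (K.imp a c)) ∈ Δ
  g2 (a b : F) : K.imp (K.and a b) a ∈ Δ
  g3 (a b : F) : K.imp (K.and a b) (K.and b a) ∈ Δ
  g4 (a : F) : K.imp a (K.and a a) ∈ Δ
  g5 (a b c : F) : K.iff (K.imp a (K.imp b c)) (K.imp (K.and a b) c) ∈ Δ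
  g6 (a b c : F) : K.imp (K.imp (K.imp a b) c) (K.imp (K.imp (K.imp b a) c) c) ∈ Δ
  g7 (a : F) : K.imp (K.const 1) a ∈ Δ
  const_of_ge (r s : UnitRat) (h : s ≤ r) : K.imp (K.const r) (K.const s) ∈ Δ
  const_of_lt (r s : UnitRat) (h : r < s) :
    K.iff (K.imp (K.const r) (K.const s)) (K.const s) ∈ Δ
  mp {a b : F} : a ∈ Δ → K.imp a b ∈ Δ → b ∈ Δ

variable {K}

namespace IsFilter

variable {Δ : Set F} (hΔ : K.IsFilter Δ)
include hΔ

theorem trans {a b c : F} (h : K.imp a b ∈ Δ) (h' : K.imp b c ∈ Δ) : K.imp a c ∈ Δ :=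
  hΔ.mp h' (hΔ.mp h (hΔ.g1 a b c))

theorem refl (a : F) : K.imp a a ∈ Δ := hΔ.trans (hΔ.g4 a) (hΔ.g2 a a)

theorem g2' (a b : F) : K.imp (K.and a b) b ∈ Δ := hΔ.trans (hΔ.g3 a b) (hΔ.g2 b a)

theorem curry {a b c : F} (h : K.imp (K.and a b) c ∈ Δ) : K.imp a (K.imp b c) ∈ Δ :=
  hΔ.mp h (hΔ.mp (hΔ.g5 a b c) (hΔ.g2' _ _))

theorem uncurry {a b c : F} (h : K.imp a (K.imp b c) ∈ Δ) : K.imp (K.and a b) c ∈ Δ :=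
  hΔ.mp h (hΔ.mp (hΔ.g5 a b c) (hΔ.g2 _ _))

theorem weaken {a : F} (b : F) (h : a ∈ Δ) : K.imp b a ∈ Δ :=
  hΔ.mp h (hΔ.curry (hΔ.g2 a b))

theorem imp_imp (a b : F) : K.imp a (K.imp b a) ∈ Δ := hΔ.curry (hΔ.g2 a b)

theorem and_intro {a b : F} (h : a ∈ Δ) (h' : b ∈ Δ) : K.and a b ∈ Δ :=
  hΔ.mp h' (hΔ.mp h (hΔ.curry (hΔ.refl _)))

theorem and_mem {a b : F} : K.and a b ∈ Δ ↔ a ∈ Δ ∧ b ∈ Δ :=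
  ⟨fun h => ⟨hΔ.mp h (hΔ.g2 a b), hΔ.mp h (hΔ.g2' a b)⟩, fun h => hΔ.and_intro h.1 h.2⟩

theorem swap {a b c : F} (h : K.imp a (K.imp b c) ∈ Δ) : K.imp b (K.imp a c) ∈ Δ :=
  hΔ.curry (hΔ.trans (hΔ.g3 b a) (hΔ.uncurry h))

theorem contract {a b : F} (h : K.imp a (K.imp a b) ∈ Δ) : K.imp a b ∈ Δ :=
  hΔ.trans (hΔ.g4 a) (hΔ.uncurry h)

theorem imp_mp {a b c : F} (h : K.imp a b ∈ Δ) (h' : K.imp a (K.imp b c) ∈ Δ) :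
    K.imp a c ∈ Δ :=
  hΔ.contract (hΔ.trans h (hΔ.swap h'))

theorem imp_and {a b c : F} (h : K.imp a b ∈ Δ) (h' : K.imp a c ∈ Δ) :
    K.imp a (K.and b c) ∈ Δ :=
  hΔ.imp_mp h' (hΔ.trans h (hΔ.curry (hΔ.refl (K.and b c))))

/-- The filter generated by a filter and one formula. -/
theorem adjoin (x : F) : K.IsFilter {a | K.imp x a ∈ Δ} where
  g1 a b c := hΔ.weaken x (hΔ.g1 a b c)
  g2 a b := hΔ.weaken x (hΔ.g2 a b)
  g3 a b := hΔ.weaken x (hΔ.g3 a b)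
  g4 a := hΔ.weaken x (hΔ.g4 a)
  g5 a b c := hΔ.weaken x (hΔ.g5 a b c)
  g6 a b c := hΔ.weaken x (hΔ.g6 a b c)
  g7 a := hΔ.weaken x (hΔ.g7 a)
  const_of_ge r s h := hΔ.weaken x (hΔ.const_of_ge r s h)
  const_of_lt r s h := hΔ.weaken x (hΔ.const_of_lt r s h)
  mp := hΔ.imp_mp

end IsFilter

/-- A superset of a filter closed under modus ponens is a filter. -/
theorem IsFilter.of_subset {Δ Δ' : Set F} (hΔ : K.IsFilter Δ) (h : Δ ⊆ Δ')
    (hmp : ∀ a b, a ∈ Δ' → K.imp a b ∈ Δ' → b ∈ Δ') : K.IsFilter Δ' where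
  g1 a b c := h (hΔ.g1 a b c)
  g2 a b := h (hΔ.g2 a b)
  g3 a b := h (hΔ.g3 a b)
  g4 a := h (hΔ.g4 a)
  g5 a b c := h (hΔ.g5 a b c)
  g6 a b c := h (hΔ.g6 a b c)
  g7 a := h (hΔ.g7 a)
  const_of_ge r s h' := h (hΔ.const_of_ge r s h')
  const_of_lt r s h' := h (hΔ.const_of_lt r s h')
  mp := hmp _ _

/-- The union of a nonempty chain of filters is a filter. -/
theorem IsFilter.sUnion {c : Set (Set F)} (hc : IsChain (· ⊆ ·) c) (hne : c.Nonempty)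
    (h : ∀ Δ ∈ c, K.IsFilter Δ) : K.IsFilter (⋃₀ c) := by
  obtain ⟨Δ₀, hΔ₀⟩ := hne
  refine (h Δ₀ hΔ₀).of_subset (Set.subset_sUnion_of_mem hΔ₀) ?_
  rintro a b ⟨Δ₁, h₁, ha⟩ ⟨Δ₂, h₂, hab⟩
  rcases hc.total h₁ h₂ with h' | h'
  · exact ⟨Δ₂, h₂, (h Δ₂ h₂).mp (h' ha) hab⟩
  · exact ⟨Δ₁, h₁, (h Δ₁ h₁).mp ha (h' hab)⟩

/-- Maximal extension of a filter disjoint from a set. -/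
theorem IsFilter.exists_maximal {Δ : Set F} (hΔ : K.IsFilter Δ) (B : Set F)
    (hB : ∀ b ∈ B, b ∉ Δ) :
    ∃ Δ', Δ ⊆ Δ' ∧ K.IsFilter Δ' ∧ (∀ b ∈ B, b ∉ Δ') ∧
      ∀ a, a ∉ Δ' → ∃ b ∈ B, K.imp a b ∈ Δ' := by
  obtain ⟨M, hM, hmax⟩ := zorn_subset_nonempty {Δ' | K.IsFilter Δ' ∧ ∀ b ∈ B, b ∉ Δ'}
    (fun c hc hch hne => ⟨⋃₀ c, ⟨.sUnion hch hne fun Δ' h => (hc h).1,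
      fun b hb ⟨_, h, hb'⟩ => (hc h).2 b hb hb'⟩,
      fun s hs => Set.subset_sUnion_of_mem hs⟩) Δ ⟨hΔ, hB⟩
  refine ⟨M, hM, hmax.prop.1, hmax.prop.2, fun a ha => ?_⟩
  by_contra! hno
  -- If `a` implied no element of `B`, adjoining `a` would give a larger filter that still avoids
  -- `B`.
  have hsub : M ⊆ {x | K.imp a x ∈ M} := fun x hx => hmax.prop.1.weaken a hx
  exact ha (hmax.le_of_ge (y := {x | K.imp a x ∈ M}) ⟨hmax.prop.1.adjoin a, hno⟩ hsub
    (hmax.prop.1.refl a))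

/-- Filters in which any two formulas are comparable. -/
structure IsPrime (K : Signature F) (Δ : Set F) : Prop extends K.IsFilter Δ where
  total (a b : F) : K.imp a b ∈ Δ ∨ K.imp b a ∈ Δ

/-- A formula outside a filter is outside some prime extension of the filter. -/
theorem IsFilter.exists_isPrime {Δ : Set F} (hΔ : K.IsFilter Δ) {x : F} (hx : x ∉ Δ) :
    ∃ Δ', Δ ⊆ Δ' ∧ K.IsPrime Δ' ∧ x ∉ Δ' := by
  obtain ⟨Δ', hsub, hfil, hB, hmax⟩ := hΔ.exists_maximal {x} (by simpa using hx)
  refine ⟨Δ', hsub, ⟨hfil, fun a b => ?_⟩, hB x rfl⟩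
  by_contra! h
  obtain ⟨_, rfl, h1⟩ := hmax _ h.1
  obtain ⟨_, rfl, h2⟩ := hmax _ h.2
  -- Prelinearity: what follows from `a → b` and from `b → a` already holds.
  exact hB _ rfl (hfil.mp h2 (hfil.mp h1 (hfil.g6 a b _)))

namespace IsPrime

variable {Δ : Set F} (hΔ : K.IsPrime Δ)
include hΔ

/-- In a chain, an implication that fails has the value of its conclusion. -/
theorem imp_imp_self {a b : F} (h : K.imp a b ∉ Δ) : K.imp (K.imp a b) b ∈ Δ := by
  rcases hΔ.total (K.imp a b) a with h' | h'
  · exact hΔ.imp_mp h' (hΔ.refl _)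
  · exact absurd (hΔ.contract h') h

theorem imp_imp_left {a b : F} (h : K.imp a b ∉ Δ) : K.imp (K.imp a b) a ∈ Δ :=
  hΔ.trans (hΔ.imp_imp_self h) ((hΔ.total a b).resolve_left h)

theorem or_mem {a b : F} : K.or a b ∈ Δ ↔ a ∈ Δ ∨ b ∈ Δ := by
  rw [Signature.or, hΔ.and_mem]
  constructor
  · rintro ⟨h, h'⟩
    rcases hΔ.total a b with h'' | h''
    · exact Or.inr (hΔ.mp h'' h)
    · exact Or.inl (hΔ.mp h'' h')
  · rintro (h | h)
    · exact ⟨hΔ.mp h (hΔ.swap (hΔ.refl _)), hΔ.weaken _ h⟩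
    · exact ⟨hΔ.weaken _ h, hΔ.mp h (hΔ.swap (hΔ.refl _))⟩

end IsPrime

namespace IsFilter

variable {Δ : Set F} (hΔ : K.IsFilter Δ)
include hΔ

/-- Prime extensions replace a derivation in the calculus: in them a disjunction holds exactly when
a disjunct does. -/
theorem or_elim {a b x : F} (h : K.or a b ∈ Δ) (ha : K.imp a x ∈ Δ) (hb : K.imp b x ∈ Δ) :
    x ∈ Δ := by
  by_contra hx
  obtain ⟨Δ', hsub, hp, hx'⟩ := hΔ.exists_isPrime hx
  rcases hp.or_mem.1 (hsub h) with h | h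
  · exact hx' (hp.mp h (hsub ha))
  · exact hx' (hp.mp h (hsub hb))

theorem or_mono (a : F) {b b' : F} (h : K.imp b b' ∈ Δ) : K.imp (K.or a b) (K.or a b') ∈ Δ := by
  by_contra hx
  obtain ⟨Δ', hsub, hp, hx'⟩ := (hΔ.adjoin (K.or a b)).exists_isPrime (x := K.or a b') hx
  refine hx' (hp.or_mem.2 ((hp.or_mem.1 (hsub (hΔ.refl _))).imp_right fun hb => hp.mp hb ?_))
  exact hsub (hΔ.weaken _ h)

end IsFilter

/-! ### Generated filters and conservativity of witnessing axioms -/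

/-- The closure of two sets of formulas under modus ponens. -/
inductive Gen (K : Signature F) (Δ Γ : Set F) : F → Prop
  | base {a : F} (h : a ∈ Δ) : Gen K Δ Γ a
  | hyp {a : F} (h : a ∈ Γ) : Gen K Δ Γ a
  | mp {a b : F} (h : Gen K Δ Γ a) (h' : Gen K Δ Γ (K.imp a b)) : Gen K Δ Γ b

theorem IsFilter.gen {Δ : Set F} (hΔ : K.IsFilter Δ) (Γ : Set F) :
    K.IsFilter {a | K.Gen Δ Γ a} :=
  hΔ.of_subset (fun _ h => .base h) fun _ _ h h' => .mp h h'

theorem Gen.subset {Δ Γ Δ' : Set F} (h : K.IsFilter Δ') (h₁ : Δ ⊆ Δ') (h₂ : Γ ⊆ Δ') {a : F}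
    (ha : K.Gen Δ Γ a) : a ∈ Δ' := by
  induction ha with
  | base h => exact h₁ h
  | hyp h => exact h₂ h
  | mp _ _ ih ih' => exact h.mp ih ih'

theorem Gen.mono {Δ Γ Γ' : Set F} (h : Γ ⊆ Γ') {a : F} (ha : K.Gen Δ Γ a) : K.Gen Δ Γ' a := by
  induction ha with
  | base h => exact .base h
  | hyp h' => exact .hyp (h h')
  | mp _ _ ih ih' => exact .mp ih ih'

theorem Gen.exists_finset {ι : Type*} [DecidableEq ι] {Δ : Set F} {A : ι → F} {a : F}
    (ha : K.Gen Δ (Set.range A) a) : ∃ R : Finset ι, K.Gen Δ (A '' R) a := by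
  induction ha with
  | base h => exact ⟨∅, .base h⟩
  | hyp h =>
    obtain ⟨i, rfl⟩ := h
    exact ⟨{i}, .hyp ⟨i, by simp, rfl⟩⟩
  | mp _ _ ih ih' =>
    obtain ⟨R, hR⟩ := ih
    obtain ⟨R', hR'⟩ := ih'
    refine ⟨R ∪ R', .mp (hR.mono (Set.image_mono ?_)) (hR'.mono (Set.image_mono ?_))⟩ <;> simp

/-- Formulas in `Gen Δ Γ` follow over `Δ` from one formula with any property shared by the members
of `Γ` and preserved by conjunctions. -/
theorem Gen.exists_imp {Δ Γ : Set F} (hΔ : K.IsFilter Δ) {p : F → Prop} (hΓ : ∀ a ∈ Γ, p a)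
    (hand : ∀ a b, p a → p b → p (K.and a b)) {t : F} (ht : p t) (htΔ : t ∈ Δ) {a : F}
    (ha : K.Gen Δ Γ a) : ∃ b, p b ∧ K.Gen Δ Γ b ∧ K.imp b a ∈ Δ := by
  induction ha with
  | base h => exact ⟨t, ht, .base htΔ, hΔ.weaken _ h⟩
  | hyp h => exact ⟨_, hΓ _ h, .hyp h, hΔ.refl _⟩
  | mp _ _ ih ih' =>
    obtain ⟨b, h1, h2, h3⟩ := ih
    obtain ⟨b', h1', h2', h3'⟩ := ih'
    exact ⟨K.and b b', hand _ _ h1 h1', (hΔ.gen Γ).and_intro h2 h2',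
      hΔ.imp_mp (hΔ.trans (hΔ.g2 _ _) h3) (hΔ.trans (hΔ.g2' _ _) h3')⟩

/-- The conservativity of a family of witnessing axioms `A i`, where `D i` is the instance of a
quantified formula `E i` at the witness. The hypothesis on `p` expresses that the witness is new. -/
theorem mem_of_gen_witness {ι : Type*} [LinearOrder ι] {A D E : ι → F} {s : F}
    (p : Set F → Prop) (hp : ∀ Δ i, p Δ → p {a | K.imp (E i) a ∈ Δ})
    (hDA : ∀ Δ, K.IsPrime Δ → ∀ i j, i ≤ j → D i ∈ Δ ∨ A j ∈ Δ)
    (hEA : ∀ Δ, K.IsFilter Δ → ∀ i, K.imp (E i) (A i) ∈ Δ)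
    (hDE : ∀ Δ, p Δ → ∀ i, K.or s (D i) ∈ Δ → K.or s (E i) ∈ Δ)
    (R : Finset ι) : ∀ Δ, K.IsFilter Δ → p Δ → K.Gen Δ (A '' R) s → s ∈ Δ := by
  induction R using Finset.induction_on_min with
  | empty =>
    intro Δ hΔ _ h
    exact h.subset hΔ subset_rfl (by simp)
  | insert i R hi ih =>
    intro Δ hΔ hpΔ h
    -- Once `E i` is adjoined, `A i` is derivable, and the induction hypothesis removes the
    -- remaining axioms.
    have h1 : K.imp (E i) s ∈ Δ := by
      refine ih _ (hΔ.adjoin (E i)) (hp _ _ hpΔ) ?_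
      refine h.subset ((hΔ.adjoin (E i)).gen _) (fun a ha => .base (hΔ.weaken _ ha)) ?_
      rintro _ ⟨j, hj, rfl⟩
      rcases Finset.mem_insert.1 (Finset.mem_coe.1 hj) with rfl | hj
      · exact .base (hEA _ hΔ j)
      · exact .hyp ⟨j, hj, rfl⟩
    -- As `i` is the least index, a prime extension omitting `D i` contains every `A j`, hence `s`.
    have h2 : K.or s (D i) ∈ Δ := by
      by_contra hx
      obtain ⟨Δ', hsub, hpr, hx'⟩ := hΔ.exists_isPrime hx
      rw [hpr.or_mem, not_or] at hx'
      refine hx'.1 (h.subset hpr.toIsFilter hsub ?_)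
      rintro _ ⟨j, hj, rfl⟩
      refine (hDA _ hpr i j ?_).resolve_left hx'.2
      rcases Finset.mem_insert.1 (Finset.mem_coe.1 hj) with rfl | hj
      · exact le_rfl
      · exact (hi j hj).le
    -- Newness of the witness turns `s ∨ D i` into `s ∨ E i`.
    exact hΔ.or_elim (hDE _ hpΔ i h2) (hΔ.refl s) h1

end Signature

end RGL

namespace RGL

open FirstOrder FirstOrder.Language

variable {L : FirstOrder.Language.{u, v}}

/-! ### Variable bounds and renaming in `L` -/

/-- An upper bound of the variables of a term. -/
def termBound {α : Type*} (f : α → ℕ) : L.Term α → ℕ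
  | Term.var a => f a + 1
  | Term.func _ ts => Finset.univ.sup fun i => termBound f (ts i)

theorem termBound_le_func {α : Type*} (f : α → ℕ) {n : ℕ} (g : L.Functions n)
    (ts : Fin n → L.Term α) (i : Fin n) : termBound f (ts i) ≤ termBound f (Term.func g ts) :=
  Finset.le_sup (f := fun i => termBound f (ts i)) (Finset.mem_univ i)

theorem lt_termBound {t : L.Term ℕ} {x : ℕ} (h : x ∈ t.varFinset) : x < termBound id t := by
  induction t with
  | var a => simp only [Term.varFinset, Finset.mem_singleton] at h; simp [termBound, h]
  | func g ts ih =>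
    simp only [Term.varFinset, Finset.mem_biUnion, Finset.mem_univ, true_and] at h
    obtain ⟨i, hi⟩ := h
    exact (ih i hi).trans_le (termBound_le_func id g ts i)

theorem substTerm_substTerm_cancel {t : L.Term ℕ} {x y : ℕ} (h : y ∉ t.varFinset) :
    substTerm y (Term.var x) (substTerm x (Term.var y) t) = t := by
  induction t with
  | var a =>
    simp only [Term.varFinset, Finset.mem_singleton] at h
    by_cases ha : a = x
    · simp [substTerm, Term.subst, ha]
    · simp [substTerm, Term.subst, ha, Ne.symm h]
  | func g ts ih =>
    simp only [Term.varFinset, Finset.mem_biUnion, Finset.mem_univ, true_and, not_exists] at h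
    simp only [substTerm, Term.subst]
    congr 1
    funext i
    exact ih i (h i)

theorem varFinset_substTerm {t : L.Term ℕ} {x y z : ℕ}
    (h : z ∈ (substTerm x (Term.var y) t).varFinset) : (z ∈ t.varFinset ∧ z ≠ x) ∨ z = y := by
  induction t with
  | var a =>
    by_cases ha : a = x
    · simp_all [substTerm, Term.subst, Term.varFinset]
    · simp_all [substTerm, Term.subst, Term.varFinset]
  | func g ts ih =>
    simp only [substTerm, Term.subst, Term.varFinset, Finset.mem_biUnion, Finset.mem_univ,
      true_and] at h ⊢
    obtain ⟨i, hi⟩ := h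
    rcases ih i hi with h | h
    · exact Or.inl ⟨⟨i, h.1⟩, h.2⟩
    · exact Or.inr h

namespace Formula

/-- An upper bound of the free and bound variables of a formula. -/
def bound : Formula L → ℕ
  | const _ => 0
  | rel _ ts => Finset.univ.sup fun i => termBound id (ts i)
  | and φ ψ => max φ.bound ψ.bound
  | imp φ ψ => max φ.bound ψ.bound
  | all x φ => max (x + 1) φ.bound
  | ex x φ => max (x + 1) φ.bound

theorem lt_bound {φ : Formula L} {x : ℕ} (h : x ∈ φ.freeVars) : x < φ.bound := by
  induction φ with
  | const r => simp [freeVars] at h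
  | rel R ts =>
    simp only [freeVars, Finset.mem_biUnion, Finset.mem_univ, true_and] at h
    obtain ⟨i, hi⟩ := h
    exact (lt_termBound hi).trans_le
      (Finset.le_sup (f := fun i => termBound id (ts i)) (Finset.mem_univ i))
  | and φ ψ ih ih' =>
    simp only [freeVars, Finset.mem_union] at h
    exact lt_max_iff.2 (h.imp ih ih')
  | imp φ ψ ih ih' =>
    simp only [freeVars, Finset.mem_union] at h
    exact lt_max_iff.2 (h.imp ih ih')
  | all y φ ih => exact lt_max_iff.2 (Or.inr (ih (Finset.mem_of_mem_erase h)))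
  | ex y φ ih => exact lt_max_iff.2 (Or.inr (ih (Finset.mem_of_mem_erase h)))

theorem notMem_freeVars {φ : Formula L} {x : ℕ} (h : φ.bound ≤ x) : x ∉ φ.freeVars :=
  fun hx => (lt_bound hx).not_ge h

theorem substTerm_of_notMem {t s : L.Term ℕ} {x : ℕ} (h : x ∉ t.varFinset) : substTerm x s t = t := by
  induction t with
  | var a =>
    simp only [Term.varFinset, Finset.mem_singleton] at h
    simp [substTerm, Term.subst, Ne.symm h]
  | func g ts ih =>
    simp only [Term.varFinset, Finset.mem_biUnion, Finset.mem_univ, true_and, not_exists] at h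
    simp only [substTerm, Term.subst]
    congr 1
    funext i
    exact ih i (h i)

theorem subst_of_notMem {φ : Formula L} {s : L.Term ℕ} {x : ℕ} (h : x ∉ φ.freeVars) :
    φ.subst x s = φ := by
  induction φ with
  | const r => rfl
  | rel R ts =>
    simp only [subst]
    congr 1
    funext i
    exact substTerm_of_notMem fun hy => h (Finset.mem_biUnion.2 ⟨i, Finset.mem_univ i, hy⟩)
  | and φ ψ ih ih' =>
    simp only [freeVars, Finset.mem_union, not_or] at h
    simp only [subst, ih h.1, ih' h.2]
  | imp φ ψ ih ih' =>
    simp only [freeVars, Finset.mem_union, not_or] at h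
    simp only [subst, ih h.1, ih' h.2]
  | all z φ ih =>
    by_cases hz : z = x
    · simp [subst, hz]
    · simp only [subst, if_neg hz]
      rw [ih fun hx => h (Finset.mem_erase.2 ⟨Ne.symm hz, hx⟩)]
  | ex z φ ih =>
    by_cases hz : z = x
    · simp [subst, hz]
    · simp only [subst, if_neg hz]
      rw [ih fun hx => h (Finset.mem_erase.2 ⟨Ne.symm hz, hx⟩)]

/-- `Formula.bound` covers bound variables too, so `y` is neither captured nor already present. -/
theorem subst_subst_cancel {φ : Formula L} {x y : ℕ} (h : φ.bound ≤ y) :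
    (φ.subst x (Term.var y)).subst y (Term.var x) = φ := by
  induction φ with
  | const r => rfl
  | rel R ts =>
    simp only [subst]
    congr 1
    funext i
    exact substTerm_substTerm_cancel fun hy => notMem_freeVars h
      (Finset.mem_biUnion.2 ⟨i, Finset.mem_univ i, hy⟩)
  | and φ ψ ih ih' => simp only [subst, ih (le_trans (le_max_left _ _) h),
      ih' (le_trans (le_max_right _ _) h)]
  | imp φ ψ ih ih' => simp only [subst, ih (le_trans (le_max_left _ _) h),
      ih' (le_trans (le_max_right _ _) h)]
  | all z φ ih =>
    have h1 : z + 1 ≤ y := le_trans (le_max_left _ _) h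
    have h2 : φ.bound ≤ y := le_trans (le_max_right _ _) h
    have hzy : z ≠ y := by omega
    by_cases hz : z = x
    · subst hz
      simp only [subst, if_true, if_neg hzy]
      rw [subst_of_notMem (notMem_freeVars h2)]
    · simp only [subst, if_neg hz, if_neg hzy, ih h2]
  | ex z φ ih =>
    have h1 : z + 1 ≤ y := le_trans (le_max_left _ _) h
    have h2 : φ.bound ≤ y := le_trans (le_max_right _ _) h
    have hzy : z ≠ y := by omega
    by_cases hz : z = x
    · subst hz
      simp only [subst, if_true, if_neg hzy]
      rw [subst_of_notMem (notMem_freeVars h2)]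
    · simp only [subst, if_neg hz, if_neg hzy, ih h2]

theorem freeVars_subst_var {φ : Formula L} {x y z : ℕ}
    (h : z ∈ (φ.subst x (Term.var y)).freeVars) : (z ∈ φ.freeVars ∧ z ≠ x) ∨ z = y := by
  induction φ with
  | const r => simp [subst, freeVars] at h
  | rel R ts =>
    simp only [subst, freeVars, Finset.mem_biUnion, Finset.mem_univ, true_and] at h ⊢
    obtain ⟨i, hi⟩ := h
    rcases varFinset_substTerm hi with h | h
    · exact Or.inl ⟨⟨i, h.1⟩, h.2⟩
    · exact Or.inr h
  | and φ ψ ih ih' => simp only [subst, freeVars, Finset.mem_union] at h ⊢; tauto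
  | imp φ ψ ih ih' => simp only [subst, freeVars, Finset.mem_union] at h ⊢; tauto
  | all w φ ih =>
    by_cases hw : w = x
    · simp only [subst, if_pos hw, freeVars, Finset.mem_erase] at h ⊢
      exact Or.inl ⟨h, hw ▸ h.1⟩
    · simp only [subst, if_neg hw, freeVars, Finset.mem_erase] at h ⊢
      have := ih h.2
      tauto
  | ex w φ ih =>
    by_cases hw : w = x
    · simp only [subst, if_pos hw, freeVars, Finset.mem_erase] at h ⊢
      exact Or.inl ⟨h, hw ▸ h.1⟩
    · simp only [subst, if_neg hw, freeVars, Finset.mem_erase] at h ⊢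
      have := ih h.2
      tauto

theorem substitutable_of_notMem {φ : Formula L} {t : L.Term ℕ} {x : ℕ} (h : x ∉ φ.freeVars) :
    φ.Substitutable x t := by
  induction φ with
  | const r => trivial
  | rel R ts => trivial
  | and φ ψ ih ih' =>
    simp only [freeVars, Finset.mem_union, not_or] at h
    exact ⟨ih h.1, ih' h.2⟩
  | imp φ ψ ih ih' =>
    simp only [freeVars, Finset.mem_union, not_or] at h
    exact ⟨ih h.1, ih' h.2⟩
  | all z φ ih => exact Or.inl h
  | ex z φ ih => exact Or.inl h

theorem substitutable_subst_var {φ : Formula L} {x y : ℕ} (h : φ.bound ≤ y) :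
    (φ.subst x (Term.var y)).Substitutable y (Term.var x) := by
  induction φ with
  | const r => trivial
  | rel R ts => trivial
  | and φ ψ ih ih' => exact ⟨ih (le_trans (le_max_left _ _) h), ih' (le_trans (le_max_right _ _) h)⟩
  | imp φ ψ ih ih' => exact ⟨ih (le_trans (le_max_left _ _) h), ih' (le_trans (le_max_right _ _) h)⟩
  | all z φ ih =>
    by_cases hz : z = x
    · simp only [subst, if_pos hz]
      exact substitutable_of_notMem (notMem_freeVars h)
    · simp only [subst, if_neg hz]
      exact Or.inr ⟨by simpa [Term.varFinset] using hz, ih (le_trans (le_max_right _ _) h)⟩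
  | ex z φ ih =>
    by_cases hz : z = x
    · simp only [subst, if_pos hz]
      exact substitutable_of_notMem (notMem_freeVars h)
    · simp only [subst, if_neg hz]
      exact Or.inr ⟨by simpa [Term.varFinset] using hz, ih (le_trans (le_max_right _ _) h)⟩

/-- The connectives of `Formula L`. -/
def sig (L : FirstOrder.Language.{u, v}) : Signature (Formula L) := ⟨imp, and, const⟩

end Formula

/-! ### Generalization on a fresh variable -/

open Formula

theorem isFilter_proves (T : Theory L) : (sig L).IsFilter {φ | Proves T φ} where
  g1 a b c := .ax (.g1 a b c)
  g2 a b := .ax (.g2 a b)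
  g3 a b := .ax (.g3 a b)
  g4 a := .ax (.g4 a)
  g5 a b c := .ax (.g5 a b c)
  g6 a b c := .ax (.g6 a b c)
  g7 a := .ax (.g7 a)
  const_of_ge r s h := .ax (.rgl2_of_ge r s h)
  const_of_lt r s h := .ax (.rgl2_of_lt r s h)
  mp := .mp

theorem notMem_freeVars_subst_var {φ : Formula L} {x y : ℕ} (hxy : x < y) :
    x ∉ (φ.subst x (Term.var y)).freeVars := fun h => by
  rcases freeVars_subst_var h with h | h
  · exact h.2 rfl
  · exact hxy.ne h

section Renaming

variable {T : Theory L} {φ : Formula L} {x y : ℕ} (hxy : x < y) (hφ : φ.bound ≤ y)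
include hxy hφ

theorem proves_all_rename :
    Proves T (imp (all y (φ.subst x (Term.var y))) (all x φ)) := by
  have h := Ax.all1 (L := L) y (Term.var x) _ (substitutable_subst_var (x := x) hφ)
  rw [subst_subst_cancel hφ] at h
  exact .mp (.gen x (.ax h)) (.ax (.all2 x _ _ fun h' =>
    notMem_freeVars_subst_var hxy (Finset.mem_of_mem_erase h')))

theorem proves_ex_rename :
    Proves T (imp (ex x φ) (ex y (φ.subst x (Term.var y)))) := by
  have h := Ax.ex1 (L := L) y (Term.var x) _ (substitutable_subst_var (x := x) hφ)
  rw [subst_subst_cancel hφ] at h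
  exact .mp (.gen x (.ax h)) (.ax (.ex2 x _ _ fun h' =>
    notMem_freeVars_subst_var hxy (Finset.mem_of_mem_erase h')))

/-- Universal generalization on a fresh variable, in a context. -/
theorem proves_or_all {θ ψ σ : Formula L} (hθ : θ.bound ≤ y) (hψ : ψ.bound ≤ y) (hσ : σ.bound ≤ y)
    (h : Proves T (imp θ (or σ (imp ψ (φ.subst x (Term.var y)))))) :
    Proves T (imp θ (or σ (imp ψ (all x φ)))) := by
  have hF := isFilter_proves T
  have h1 := Proves.mp (.gen y h) (.ax (.all2 y _ _ (notMem_freeVars hθ)))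
  -- The axiom `all3` lets the quantifier pass the side disjunct `σ`.
  have h2 := hF.trans h1 (Proves.ax (.all3 y _ _ (notMem_freeVars hσ)))
  refine hF.trans h2 (hF.or_mono σ ?_)
  refine hF.trans (b := imp ψ (all y (φ.subst x (Term.var y))))
    (Proves.ax (.all2 y _ _ (notMem_freeVars hψ))) ?_
  exact hF.mp (proves_all_rename hxy hφ) (hF.swap (hF.g1 _ _ _))

/-- Existential generalization on a fresh variable, in a context. -/
theorem proves_or_ex {θ ψ σ : Formula L} (hθ : θ.bound ≤ y) (hψ : ψ.bound ≤ y) (hσ : σ.bound ≤ y)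
    (h : Proves T (imp θ (or σ (imp (φ.subst x (Term.var y)) ψ)))) :
    Proves T (imp θ (or σ (imp (ex x φ) ψ))) := by
  have hF := isFilter_proves T
  have h1 := Proves.mp (.gen y h) (.ax (.all2 y _ _ (notMem_freeVars hθ)))
  have h2 := hF.trans h1 (Proves.ax (.all3 y _ _ (notMem_freeVars hσ)))
  refine hF.trans h2 (hF.or_mono σ ?_)
  refine hF.trans (b := imp (ex y (φ.subst x (Term.var y))) ψ)
    (Proves.ax (.ex2 y _ _ (notMem_freeVars hψ))) ?_
  exact hF.mp (proves_ex_rename hxy hφ) (hF.g1 _ _ _)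

end Renaming

end RGL

namespace RGL

open FirstOrder FirstOrder.Language

variable {L : FirstOrder.Language.{u, v}}

/-! ### Formulas with parameters -/

/-- Formulas over the variables `Sum.inl x` with parameters `Sum.inr c`. -/
inductive PForm (L : FirstOrder.Language.{u, v}) : Type (max u v)
  | const (r : UnitRat) : PForm L
  | rel {n : ℕ} (R : L.Relations n) (ts : Fin n → L.Term (ℕ ⊕ ℕ)) : PForm L
  | and (φ ψ : PForm L) : PForm L
  | imp (φ ψ : PForm L) : PForm L
  | all (x : ℕ) (φ : PForm L) : PForm L
  | ex (x : ℕ) (φ : PForm L) : PForm L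

/-- A term over parameters, as a term over variables and parameters. -/
def closedTerm (t : L.Term ℕ) : L.Term (ℕ ⊕ ℕ) := t.relabel Sum.inr

/-- Substitution of a term over parameters for a variable. -/
def psubstTerm (x : ℕ) (t : L.Term ℕ) (s : L.Term (ℕ ⊕ ℕ)) : L.Term (ℕ ⊕ ℕ) :=
  s.subst fun v => if v = Sum.inl x then closedTerm t else Term.var v

/-- The translation of terms with parameters, which turns the parameter `c` into the variable
`N + c`. -/
def trTerm (N : ℕ) (t : L.Term (ℕ ⊕ ℕ)) : L.Term ℕ := t.relabel (Sum.elim id (N + ·))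

theorem trTerm_closedTerm (N : ℕ) (t : L.Term ℕ) :
    trTerm N (closedTerm t) = t.relabel (N + ·) := by
  simp only [trTerm, closedTerm, Term.relabel_relabel]
  rfl

theorem trTerm_psubstTerm {N x : ℕ} (h : x < N) (t : L.Term ℕ) (s : L.Term (ℕ ⊕ ℕ)) :
    trTerm N (psubstTerm x t s) = substTerm x (t.relabel (N + ·)) (trTerm N s) := by
  induction s with
  | var a =>
    rcases a with y | c
    · by_cases hy : y = x
      · subst hy
        simpa [psubstTerm, substTerm, Term.subst, trTerm] using trTerm_closedTerm N t
      · simp [psubstTerm, substTerm, Term.subst, trTerm, hy]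
    · have : N + c ≠ x := by omega
      simp [psubstTerm, substTerm, Term.subst, trTerm, this]
  | func g ts ih =>
    simp only [psubstTerm, substTerm, Term.subst, trTerm, Term.relabel] at ih ⊢
    congr 1
    funext i
    exact ih i

theorem termBound_trTerm (N : ℕ) (t : L.Term (ℕ ⊕ ℕ)) :
    termBound id (trTerm N t) ≤ N + termBound (Sum.elim id id) t := by
  induction t with
  | var a =>
    rcases a with y | c <;> simp only [trTerm, Term.relabel, termBound, Sum.elim_inl, Sum.elim_inr,
      id] <;> omega
  | func g ts ih =>
    refine Finset.sup_le fun i _ => (ih i).trans ?_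
    exact Nat.add_le_add_left (termBound_le_func _ g ts i) N

theorem termBound_psubstTerm (x c : ℕ) (t : L.Term (ℕ ⊕ ℕ)) :
    termBound (Sum.elim id id) (psubstTerm x (Term.var c) t) ≤
      max (termBound (Sum.elim id id) t) (c + 1) := by
  induction t with
  | var a =>
    by_cases h : a = Sum.inl x
    · simp [psubstTerm, Term.subst, h, closedTerm, Term.relabel, termBound]
    · simp [psubstTerm, Term.subst, h]
  | func g ts ih =>
    refine Finset.sup_le fun i _ => (ih i).trans ?_
    exact max_le_max_right _ (termBound_le_func _ g ts i)

theorem le_of_mem_varFinset_relabel {N y : ℕ} {t : L.Term ℕ}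
    (h : y ∈ (t.relabel (N + ·)).varFinset) : N ≤ y := by
  induction t with
  | var a =>
    simp only [Term.relabel, Term.varFinset, Finset.mem_singleton] at h
    omega
  | func g ts ih =>
    simp only [Term.relabel, Term.varFinset, Finset.mem_biUnion, Finset.mem_univ, true_and] at h
    obtain ⟨i, hi⟩ := h
    exact ih i hi

namespace PForm

/-- An upper bound of the variables and parameters of a formula. -/
def bound : PForm L → ℕ
  | const _ => 0
  | rel _ ts => Finset.univ.sup fun i => termBound (Sum.elim id id) (ts i)
  | and φ ψ => max φ.bound ψ.bound
  | imp φ ψ => max φ.bound ψ.bound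
  | all x φ => max (x + 1) φ.bound
  | ex x φ => max (x + 1) φ.bound

/-- Substitution of a term over parameters for a variable. -/
def subst (x : ℕ) (t : L.Term ℕ) : PForm L → PForm L
  | const r => const r
  | rel R ts => rel R fun i => psubstTerm x t (ts i)
  | and φ ψ => and (subst x t φ) (subst x t ψ)
  | imp φ ψ => imp (subst x t φ) (subst x t ψ)
  | all y φ => if y = x then all y φ else all y (subst x t φ)
  | ex y φ => if y = x then ex y φ else ex y (subst x t φ)

/-- The translation which turns the parameter `c` into the variable `N + c`. -/
def tr (N : ℕ) : PForm L → Formula L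
  | const r => .const r
  | rel R ts => .rel R fun i => trTerm N (ts i)
  | and φ ψ => .and (tr N φ) (tr N ψ)
  | imp φ ψ => .imp (tr N φ) (tr N ψ)
  | all x φ => .all x (tr N φ)
  | ex x φ => .ex x (tr N φ)

theorem tr_subst {N x : ℕ} (h : x < N) (t : L.Term ℕ) (φ : PForm L) :
    (φ.subst x t).tr N = (φ.tr N).subst x (t.relabel (N + ·)) := by
  induction φ with
  | const r => rfl
  | rel R ts =>
    simp only [subst, tr, Formula.subst]
    congr 1
    funext i
    exact trTerm_psubstTerm h t (ts i)
  | and φ ψ ih ih' => simp only [subst, tr, Formula.subst, ih, ih']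
  | imp φ ψ ih ih' => simp only [subst, tr, Formula.subst, ih, ih']
  | all y φ ih =>
    by_cases hy : y = x
    · simp only [subst, tr, Formula.subst, if_pos hy]
    · simp only [subst, tr, Formula.subst, if_neg hy, ih]
  | ex y φ ih =>
    by_cases hy : y = x
    · simp only [subst, tr, Formula.subst, if_pos hy]
    · simp only [subst, tr, Formula.subst, if_neg hy, ih]

theorem bound_tr (N : ℕ) (φ : PForm L) : (φ.tr N).bound ≤ N + φ.bound := by
  induction φ with
  | const r => exact Nat.zero_le _
  | rel R ts =>
    refine Finset.sup_le fun i _ => (termBound_trTerm N (ts i)).trans (Nat.add_le_add_left ?_ N)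
    exact Finset.le_sup (f := fun i => termBound (Sum.elim id id) (ts i)) (Finset.mem_univ i)
  | and φ ψ ih ih' => simp only [tr, Formula.bound, bound]; omega
  | imp φ ψ ih ih' => simp only [tr, Formula.bound, bound]; omega
  | all y φ ih => simp only [tr, Formula.bound, bound]; omega
  | ex y φ ih => simp only [tr, Formula.bound, bound]; omega

theorem bound_subst (x c : ℕ) (φ : PForm L) :
    (φ.subst x (Term.var c)).bound ≤ max φ.bound (c + 1) := by
  induction φ with
  | const r => exact Nat.zero_le _
  | rel R ts =>
    refine Finset.sup_le fun i _ => (termBound_psubstTerm x c (ts i)).trans (max_le_max_right _ ?_)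
    exact Finset.le_sup (f := fun i => termBound (Sum.elim id id) (ts i)) (Finset.mem_univ i)
  | and φ ψ ih ih' => simp only [subst, bound]; omega
  | imp φ ψ ih ih' => simp only [subst, bound]; omega
  | all y φ ih => simp only [subst]; split_ifs <;> simp only [bound] <;> omega
  | ex y φ ih => simp only [subst]; split_ifs <;> simp only [bound] <;> omega

theorem substitutable_tr {N : ℕ} (x : ℕ) (t : L.Term ℕ) {φ : PForm L} (h : φ.bound ≤ N) :
    (φ.tr N).Substitutable x (t.relabel (N + ·)) := by
  induction φ with
  | const r => trivial
  | rel R ts => trivial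
  | and φ ψ ih ih' => exact ⟨ih (le_trans (le_max_left _ _) h), ih' (le_trans (le_max_right _ _) h)⟩
  | imp φ ψ ih ih' => exact ⟨ih (le_trans (le_max_left _ _) h), ih' (le_trans (le_max_right _ _) h)⟩
  | all y φ ih =>
    refine Or.inr ⟨fun hy => ?_, ih (le_trans (le_max_right _ _) h)⟩
    exact absurd (le_of_mem_varFinset_relabel hy) (not_le.2 (le_trans (le_max_left _ _) h))
  | ex y φ ih =>
    refine Or.inr ⟨fun hy => ?_, ih (le_trans (le_max_right _ _) h)⟩
    exact absurd (le_of_mem_varFinset_relabel hy) (not_le.2 (le_trans (le_max_left _ _) h))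

/-- The connectives of `PForm L`. -/
def sig (L : FirstOrder.Language.{u, v}) : Signature (PForm L) := ⟨imp, and, const⟩

/-- The nesting depth. -/
def depth : PForm L → ℕ
  | const _ => 0
  | rel _ _ => 0
  | and φ ψ => max φ.depth ψ.depth + 1
  | imp φ ψ => max φ.depth ψ.depth + 1
  | all _ φ => φ.depth + 1
  | ex _ φ => φ.depth + 1

instance [Countable (Σ n, L.Functions n)] [Countable (Σ n, L.Relations n)] :
    Countable (PForm L) := by
  let at' : (Σ p : Σ n, L.Relations n, Fin p.1 → L.Term (ℕ ⊕ ℕ)) → PForm L := fun p => rel p.1.2 p.2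
  have key : ∀ n, {φ : PForm L | φ.depth ≤ n}.Countable := by
    intro n
    induction n with
    | zero =>
      refine ((Set.countable_range (const (L := L))).union (Set.countable_range at')).mono ?_
      intro φ hφ
      cases φ with
      | const r => exact Or.inl ⟨r, rfl⟩
      | rel R ts => exact Or.inr ⟨⟨⟨_, R⟩, ts⟩, rfl⟩
      | and φ ψ => exact absurd hφ (by simp [depth])
      | imp φ ψ => exact absurd hφ (by simp [depth])
      | all y φ => exact absurd hφ (by simp [depth])
      | ex y φ => exact absurd hφ (by simp [depth])
    | succ n ih =>
      refine ((((((Set.countable_range (const (L := L))).union (Set.countable_range at')).union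
        (ih.image2 ih and)).union (ih.image2 ih imp)).union
        (Set.countable_univ.image2 ih all)).union (Set.countable_univ.image2 ih ex)).mono ?_
      intro φ hφ
      cases φ with
      | const r => exact Or.inl (Or.inl (Or.inl (Or.inl (Or.inl ⟨r, rfl⟩))))
      | rel R ts => exact Or.inl (Or.inl (Or.inl (Or.inl (Or.inr ⟨⟨⟨_, R⟩, ts⟩, rfl⟩))))
      | and φ ψ =>
        have h := max_le_iff.1 (Nat.le_of_succ_le_succ hφ)
        exact Or.inl (Or.inl (Or.inl (Or.inr ⟨φ, h.1, ψ, h.2, rfl⟩)))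
      | imp φ ψ =>
        have h := max_le_iff.1 (Nat.le_of_succ_le_succ hφ)
        exact Or.inl (Or.inl (Or.inr ⟨φ, h.1, ψ, h.2, rfl⟩))
      | all y φ => exact Or.inl (Or.inr ⟨y, trivial, φ, Nat.le_of_succ_le_succ hφ, rfl⟩)
      | ex y φ => exact Or.inr ⟨y, trivial, φ, Nat.le_of_succ_le_succ hφ, rfl⟩
  have hall : (Set.univ : Set (PForm L)).Countable := by
    refine (Set.countable_iUnion key).mono fun φ _ => Set.mem_iUnion.2 ⟨φ.depth, le_refl φ.depth⟩
  exact Set.countable_univ_iff.1 hall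

end PForm

/-! ### Provability with parameters, read as variables beyond those in use -/

open PForm Filter

/-- The formulas with parameters whose translations are provable. -/
def provable (T : Theory L) : Set (PForm L) := {φ | ∀ᶠ N in atTop, Proves T (φ.tr N)}

theorem isFilter_provable (T : Theory L) : (sig L).IsFilter (provable T) where
  g1 a b c := .of_forall fun _ => .ax (.g1 _ _ _)
  g2 a b := .of_forall fun _ => .ax (.g2 _ _)
  g3 a b := .of_forall fun _ => .ax (.g3 _ _)
  g4 a := .of_forall fun _ => .ax (.g4 _)
  g5 a b c := .of_forall fun _ => .ax (.g5 _ _ _)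
  g6 a b c := .of_forall fun _ => .ax (.g6 _ _ _)
  g7 a := .of_forall fun _ => .ax (.g7 _)
  const_of_ge r s h := .of_forall fun _ => .ax (.rgl2_of_ge r s h)
  const_of_lt r s h := .of_forall fun _ => .ax (.rgl2_of_lt r s h)
  mp {a b} h h' := by
    filter_upwards [h, h'] with N h1 h2 using .mp h1 h2

theorem const_notMem_provable {T : Theory L} (hT : StronglyConsistent T) (r : UnitRat)
    (hr : 0 < r) : PForm.const r ∉ provable T := fun h => by
  obtain ⟨N, hN⟩ := h.exists
  exact hT r hr hN

theorem all_imp_subst_mem_provable (T : Theory L) (x : ℕ) (t : L.Term ℕ) (φ : PForm L) :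
    imp (all x φ) (φ.subst x t) ∈ provable T := by
  filter_upwards [eventually_gt_atTop x, eventually_ge_atTop φ.bound] with N h1 h2
  simp only [tr, tr_subst h1]
  exact .ax (.all1 _ _ _ (substitutable_tr x t h2))

theorem subst_imp_ex_mem_provable (T : Theory L) (x : ℕ) (t : L.Term ℕ) (φ : PForm L) :
    imp (φ.subst x t) (ex x φ) ∈ provable T := by
  filter_upwards [eventually_gt_atTop x, eventually_ge_atTop φ.bound] with N h1 h2
  simp only [tr, tr_subst h1]
  exact .ax (.ex1 _ _ _ (substitutable_tr x t h2))

/-- The parameter `c` is new for the filter `Δ`: from instances at `c` of formulas without `c`, one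
may pass to quantified formulas. -/
structure Fresh (c : ℕ) (Δ : Set (PForm L)) : Prop where
  -- The context `θ` makes the property stable under adjoining formulas; `σ` is the place of the
  -- formula `s` of `mem_of_gen_witness`.
  all {x : ℕ} {φ θ ψ σ : PForm L} (hx : x < c) (hφ : φ.bound ≤ c) (hθ : θ.bound ≤ c)
    (hψ : ψ.bound ≤ c) (hσ : σ.bound ≤ c)
    (h : imp θ ((sig L).or σ (imp ψ (φ.subst x (Term.var c)))) ∈ Δ) :
    imp θ ((sig L).or σ (imp ψ (all x φ))) ∈ Δ
  ex {x : ℕ} {φ θ ψ σ : PForm L} (hx : x < c) (hφ : φ.bound ≤ c) (hθ : θ.bound ≤ c)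
    (hψ : ψ.bound ≤ c) (hσ : σ.bound ≤ c)
    (h : imp θ ((sig L).or σ (imp (φ.subst x (Term.var c)) ψ)) ∈ Δ) :
    imp θ ((sig L).or σ (imp (ex x φ) ψ)) ∈ Δ

/-- The parameter `c` becomes the variable `N + c`, and a formula of bound at most `c` gets a
translation of bound at most `N + c`. -/
theorem fresh_provable (T : Theory L) (c : ℕ) : Fresh c (provable T) where
  all {x φ θ ψ σ} hx hφ hθ hψ hσ h := by
    have hb : ∀ {χ : PForm L} (N : ℕ), χ.bound ≤ c → (χ.tr N).bound ≤ N + c := fun N hχ =>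
      (bound_tr N _).trans (Nat.add_le_add_left hχ N)
    filter_upwards [h, eventually_gt_atTop x] with N h h1
    refine proves_or_all (y := N + c) (by omega) (hb N hφ) (hb N hθ) (hb N hψ) (hb N hσ) ?_
    have h2 := tr_subst h1 (Term.var c) φ
    simp only [Term.relabel] at h2
    rw [← h2]
    exact h
  ex {x φ θ ψ σ} hx hφ hθ hψ hσ h := by
    have hb : ∀ {χ : PForm L} (N : ℕ), χ.bound ≤ c → (χ.tr N).bound ≤ N + c := fun N hχ =>
      (bound_tr N _).trans (Nat.add_le_add_left hχ N)
    filter_upwards [h, eventually_gt_atTop x] with N h h1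
    refine proves_or_ex (y := N + c) (by omega) (hb N hφ) (hb N hθ) (hb N hψ) (hb N hσ) ?_
    have h2 := tr_subst h1 (Term.var c) φ
    simp only [Term.relabel] at h2
    rw [← h2]
    exact h

/-- The adjoined formula becomes a conjunct of the context `θ`. -/
theorem Fresh.adjoin {c : ℕ} {Δ : Set (PForm L)} (h : Fresh c Δ) (hΔ : (sig L).IsFilter Δ)
    {χ : PForm L} (hχ : χ.bound ≤ c) : Fresh c {φ | imp χ φ ∈ Δ} where
  all hx hφ hθ hψ hσ h' :=
    hΔ.curry (h.all (θ := PForm.and χ _) hx hφ (max_le hχ hθ) hψ hσ (hΔ.uncurry h'))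
  ex hx hφ hθ hψ hσ h' :=
    hΔ.curry (h.ex (θ := PForm.and χ _) hx hφ (max_le hχ hθ) hψ hσ (hΔ.uncurry h'))

/-- A derivation uses finitely many formulas of `Γ`, and their conjunction, still of bound at most
`c`, can be adjoined. -/
theorem Fresh.gen {c : ℕ} {Δ : Set (PForm L)} (h : Fresh c Δ) (hΔ : (sig L).IsFilter Δ)
    {Γ : Set (PForm L)} (hΓ : ∀ χ ∈ Γ, χ.bound ≤ c) : Fresh c {φ | (sig L).Gen Δ Γ φ} := by
  have key : ∀ {a : PForm L}, (sig L).Gen Δ Γ a →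
      ∃ b : PForm L, b.bound ≤ c ∧ (sig L).Gen Δ Γ b ∧ (sig L).imp b a ∈ Δ := fun ha =>
    ha.exists_imp (p := fun χ => χ.bound ≤ c) hΔ hΓ (fun a b => max_le)
      (t := imp (const 0) (const 0)) (by simp [bound]) (hΔ.refl _)
  constructor
  · intro x φ θ ψ σ hx hφ hθ hψ hσ h'
    obtain ⟨b, h1, h2, h3⟩ := key h'
    exact .mp h2 (.base ((h.adjoin hΔ h1).all hx hφ hθ hψ hσ h3))
  · intro x φ θ ψ σ hx hφ hθ hψ hσ h'
    obtain ⟨b, h1, h2, h3⟩ := key h'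
    exact .mp h2 (.base ((h.adjoin hΔ h1).ex hx hφ hθ hψ hσ h3))

end RGL

namespace RGL

open FirstOrder FirstOrder.Language

variable {L : FirstOrder.Language.{u, v}}

open PForm

/-! ### Witnesses -/

/-- The formulas with which a quantified formula is compared: either a given formula, or all the
constants. -/
def comparison : Option (PForm L) → UnitRat → PForm L
  | none => const
  | some ψ => fun _ => ψ

/-- The axiom saying that the term `t` is a witness for a quantified formula, compared to `ψ`. The
formula is universal for the boolean `true`, and existential otherwise. -/
def witnessAx (b : Bool) (x : ℕ) (φ ψ : PForm L) (t : L.Term ℕ) : PForm L :=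
  -- For `ψ` outside a prime filter, the universal axiom says that `φ(t)` lies strictly above `ψ` if
  -- `∀ x φ` does. The shorter `(ψ → φ(t)) → (ψ → ∀ x φ)` need not hold when `ψ → φ(t)` fails, and
  -- conservativity requires this of the axiom.
  if b then imp (imp (imp ψ (all x φ)) ψ) (imp (imp ψ (φ.subst x t)) ψ)
  else imp (imp (φ.subst x t) ψ) (imp (ex x φ) ψ)

theorem comparison_mem {Δ : Set (PForm L)} (hΔ : (sig L).IsFilter Δ) (o : Option (PForm L))
    {r s : UnitRat} (h : r ≤ s) : imp (comparison o s) (comparison o r) ∈ Δ := by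
  cases o with
  | none => exact hΔ.const_of_ge s r h
  | some ψ => exact hΔ.refl ψ

theorem bound_comparison_le {o : Option (PForm L)} {c : ℕ} (ho : ∀ ψ ∈ o, ψ.bound ≤ c)
    (r : UnitRat) : (comparison o r).bound ≤ c := by
  cases o with
  | none => exact Nat.zero_le _
  | some ψ => exact ho ψ rfl

theorem bound_witnessAx {b : Bool} {x c : ℕ} {φ ψ : PForm L} (hx : x < c) (hφ : φ.bound ≤ c)
    (hψ : ψ.bound ≤ c) : (witnessAx b x φ ψ (Term.var c)).bound ≤ c + 1 := by
  have := bound_subst x c φ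
  unfold witnessAx
  split_ifs <;> simp only [bound] <;> omega

/-- Adding witnessing axioms for a new parameter is conservative for the constants. -/
theorem const_mem_of_gen_witnessAx {Δ : Set (PForm L)} (hΔ : (sig L).IsFilter Δ) {c : ℕ}
    (hc : Fresh c Δ) (b : Bool) {x : ℕ} {φ : PForm L} {o : Option (PForm L)} (hx : x < c)
    (hφ : φ.bound ≤ c) (ho : ∀ ψ ∈ o, ψ.bound ≤ c) {s : UnitRat}
    (h : (sig L).Gen Δ (Set.range fun r => witnessAx b x φ (comparison o r) (Term.var c))
      (const s)) : const s ∈ Δ := by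
  obtain ⟨R, hR⟩ := h.exists_finset
  have hb := bound_comparison_le ho
  have hQ : max (x + 1) φ.bound ≤ c := max_le hx hφ
  have triv : ∀ {Δ : Set (PForm L)}, (sig L).IsFilter Δ →
      imp (const 0) (const 0) ∈ Δ := fun h => h.refl _
  cases b with
  | false =>
    refine Signature.mem_of_gen_witness (K := sig L) (ι := UnitRat)
      (D := fun r => imp (φ.subst x (Term.var c)) (comparison o r))
      (E := fun r => imp (ex x φ) (comparison o r))
      (fun Δ => (sig L).IsFilter Δ ∧ Fresh c Δ) ?_ ?_ ?_ ?_ R Δ hΔ ⟨hΔ, hc⟩ hR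
    · exact fun Δ i h => ⟨h.1.adjoin _, h.2.adjoin h.1 (max_le hQ (hb i))⟩
    · intro Δ h i j hij
      refine or_iff_not_imp_left.2 fun hD => ?_
      have h1 : imp (φ.subst x (Term.var c)) (comparison o j) ∉ Δ := fun h' =>
        hD (h.trans h' (comparison_mem h.toIsFilter o hij))
      exact h.trans (h.imp_imp_self h1) (h.imp_imp _ _)
    · exact fun Δ h i => h.imp_imp _ _
    · intro Δ h i h'
      exact h.1.mp (triv h.1) (h.2.ex hx hφ (by simp [bound]) (hb i) (Nat.zero_le _)
        (h.1.weaken _ h'))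
  | true =>
    -- The order is dual because a formula strictly above a constant is above all smaller ones; in
    -- the existential case, one strictly below a constant is below all larger ones.
    refine Signature.mem_of_gen_witness (K := sig L) (ι := UnitRatᵒᵈ)
      (D := fun r => imp (comparison o (OrderDual.ofDual r)) (φ.subst x (Term.var c)))
      (E := fun r => imp (comparison o (OrderDual.ofDual r)) (all x φ))
      (fun Δ => (sig L).IsFilter Δ ∧ Fresh c Δ) ?_ ?_ ?_ ?_ R Δ hΔ ⟨hΔ, hc⟩ hR
    · exact fun Δ i h => ⟨h.1.adjoin _, h.2.adjoin h.1 (max_le (hb _) hQ)⟩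
    · intro Δ h i j hij
      refine or_iff_not_imp_left.2 fun hD => ?_
      have h1 : imp (comparison o (OrderDual.ofDual j)) (φ.subst x (Term.var c)) ∉ Δ := fun h' =>
        hD (h.trans (comparison_mem h.toIsFilter o (OrderDual.ofDual_le_ofDual.2 hij)) h')
      have h2 := (h.total _ _).resolve_left h1
      exact h.weaken _ (h.trans (h.imp_imp_self h1) h2)
    · exact fun Δ h i => h.curry (h.trans (h.imp_mp (h.g2 _ _) (h.g2' _ _)) (h.imp_imp _ _))
    · intro Δ h i h'
      exact h.1.mp (triv h.1) (h.2.all hx hφ (by simp [bound]) (hb _) (Nat.zero_le _)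
        (h.1.weaken _ h'))

/-- A sequence of strictly increasing numbers above a given one. -/
def aboveSeq (f : ℕ → ℕ) : ℕ → ℕ
  | 0 => f 0
  | k + 1 => max (aboveSeq f k + 1) (f (k + 1))

theorem le_aboveSeq (f : ℕ → ℕ) (k : ℕ) : f k ≤ aboveSeq f k := by
  cases k with
  | zero => exact le_rfl
  | succ k => exact le_max_right _ _

theorem strictMono_aboveSeq (f : ℕ → ℕ) : StrictMono (aboveSeq f) :=
  strictMono_nat_of_lt_succ fun _ => Nat.lt_of_succ_le (le_max_left _ _)

/-- Saturated sets: maximal among the strongly consistent ones, and containing witnesses. -/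
structure Saturated (T : Theory L) (Δ : Set (PForm L)) : Prop extends (sig L).IsPrime Δ where
  provable_subset : provable T ⊆ Δ
  const_notMem (r : UnitRat) (hr : 0 < r) : const r ∉ Δ
  -- This is the Archimedean hypothesis of `exists_truthValue_embedding`.
  exists_imp_const (φ : PForm L) (h : φ ∉ Δ) : ∃ r : UnitRat, 0 < r ∧ imp φ (const r) ∈ Δ
  -- For `o = none` the same term serves for all constants.
  exists_witness (b : Bool) (x : ℕ) (φ : PForm L) (o : Option (PForm L)) :
    ∃ t : L.Term ℕ, ∀ r, witnessAx b x φ (comparison o r) t ∈ Δ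

/-- The witnessing axioms can be added to the provable formulas. -/
theorem exists_witnessed [Countable (PForm L)] {T : Theory L} (hT : StronglyConsistent T) :
    ∃ Δ : Set (PForm L), (sig L).IsFilter Δ ∧ provable T ⊆ Δ ∧
      (∀ r : UnitRat, 0 < r → const r ∉ Δ) ∧
      ∀ b x φ o, ∃ t : L.Term ℕ, ∀ r, witnessAx b x φ (comparison o r) t ∈ Δ := by
  have : Nonempty (PForm L) := ⟨const 0⟩
  have : Countable (Option (PForm L)) :=
    (Equiv.optionEquivSumPUnit.{0} (PForm L)).injective.countable
  obtain ⟨e, he⟩ := exists_surjective_nat (Bool × ℕ × PForm L × Option (PForm L))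
  let f : ℕ → ℕ := fun k =>
    max (max ((e k).2.1 + 1) (e k).2.2.1.bound) ((e k).2.2.2.elim 0 bound)
  -- The axioms for `c k` have bound at most `c k + 1`, so strict growth keeps the later `c m`
  -- fresh.
  let c := aboveSeq f
  let Γ : ℕ → Set (PForm L) := fun k => Set.range fun r =>
    witnessAx (e k).1 (e k).2.1 (e k).2.2.1 (comparison (e k).2.2.2 r) (Term.var (c k))
  let S : ℕ → Set (PForm L) := fun k => Nat.rec (provable T) (fun k Δ => {φ | (sig L).Gen Δ (Γ k) φ}) k
  have hS : ∀ k, S (k + 1) = {φ | (sig L).Gen (S k) (Γ k) φ} := fun k => rfl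
  have hx : ∀ k, (e k).2.1 < c k := fun k =>
    (le_trans (le_max_left _ _) (le_max_left _ _)).trans (le_aboveSeq f k)
  have hφ : ∀ k, (e k).2.2.1.bound ≤ c k := fun k =>
    (le_trans (le_max_right _ _) (le_max_left _ _)).trans (le_aboveSeq f k)
  have ho : ∀ k, ∀ ψ ∈ (e k).2.2.2, ψ.bound ≤ c k := fun k ψ hψ => by
    refine le_trans ?_ (le_aboveSeq f k)
    have h : (e k).2.2.2 = some ψ := hψ
    simp only [f, h]
    exact le_max_right _ _
  have hinv : ∀ k, (sig L).IsFilter (S k) ∧ (∀ m, k ≤ m → Fresh (c m) (S k)) ∧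
      ∀ r : UnitRat, 0 < r → const r ∉ S k := by
    intro k
    induction k with
    | zero => exact ⟨isFilter_provable T, fun m _ => fresh_provable T _, const_notMem_provable hT⟩
    | succ k ih =>
      obtain ⟨h1, h2, h3⟩ := ih
      rw [hS]
      refine ⟨h1.gen _, fun m hm => (h2 m (by omega)).gen h1 ?_, fun r hr h => h3 r hr ?_⟩
      · rintro _ ⟨r, rfl⟩
        exact (bound_witnessAx (hx k) (hφ k) (bound_comparison_le (ho k) r)).trans
          (strictMono_aboveSeq f (Nat.lt_of_succ_le hm))
      · exact const_mem_of_gen_witnessAx h1 (h2 k le_rfl) _ (hx k) (hφ k) (ho k) h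
  have hmono : Monotone S := monotone_nat_of_le_succ fun k φ h => .base h
  refine ⟨⋃ k, S k, ?_, Set.subset_iUnion S 0, fun r hr h => ?_, fun b x φ o => ?_⟩
  · refine (hinv 0).1.of_subset (Set.subset_iUnion S 0) fun a b ha hab => ?_
    obtain ⟨k, hk⟩ := Set.mem_iUnion.1 ha
    obtain ⟨l, hl⟩ := Set.mem_iUnion.1 hab
    exact Set.mem_iUnion.2 ⟨max k l, (hinv _).1.mp (hmono (le_max_left k l) hk)
      (hmono (le_max_right k l) hl)⟩
  · obtain ⟨k, hk⟩ := Set.mem_iUnion.1 h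
    exact (hinv k).2.2 r hr hk
  · obtain ⟨k, hk⟩ := he (b, x, φ, o)
    refine ⟨Term.var (c k), fun r => Set.mem_iUnion.2 ⟨k + 1, ?_⟩⟩
    rw [hS]
    refine .hyp ⟨r, ?_⟩
    simp only [hk]

theorem exists_saturated [Countable (PForm L)] {T : Theory L} (hT : StronglyConsistent T) :
    ∃ Δ, Saturated T Δ := by
  obtain ⟨Δ₀, hfil, hprov, hcon, hwit⟩ := exists_witnessed hT
  obtain ⟨Δ, hsub, hΔ, hB, hmax⟩ := hfil.exists_maximal {φ | ∃ r : UnitRat, 0 < r ∧ φ = const r}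
    (by rintro _ ⟨r, hr, rfl⟩; exact hcon r hr)
  have hmax' : ∀ φ ∉ Δ, ∃ r : UnitRat, 0 < r ∧ imp φ (const r) ∈ Δ := fun φ hφ => by
    obtain ⟨_, ⟨r, hr, rfl⟩, h⟩ := hmax φ hφ
    exact ⟨r, hr, h⟩
  refine ⟨Δ, ⟨hΔ, fun a b => ?_⟩, hprov.trans hsub, fun r hr => hB _ ⟨r, hr, rfl⟩, hmax',
    fun b x φ o => (hwit b x φ o).imp fun t h r => hsub (h r)⟩
  by_contra! h
  obtain ⟨r, hr, h1⟩ := hmax' _ h.1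
  obtain ⟨s, hs, h2⟩ := hmax' _ h.2
  -- Both implications are weakened to the common constant `min r s`, to which prelinearity applies.
  have h1' := hΔ.trans h1 (hΔ.const_of_ge r (min r s) (min_le_left _ _))
  have h2' := hΔ.trans h2 (hΔ.const_of_ge s (min r s) (min_le_right _ _))
  exact hB _ ⟨min r s, lt_min hr hs, rfl⟩ (hΔ.mp h2' (hΔ.mp h1' (hΔ.g6 a b _)))

end RGL

namespace RGL

open FirstOrder FirstOrder.Language

variable {L : FirstOrder.Language.{u, v}}

open PForm

/-! ### Truth values of formulas with parameters -/

namespace Saturated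

variable {T : Theory L} {Δ : Set (PForm L)} (hΔ : Saturated T Δ)
include hΔ

/-- Otherwise `0 → r` would be in `Δ` for some `r > 0`, and this is equivalent to `r`. -/
theorem const_zero_mem : const 0 ∈ Δ := by
  by_contra h
  obtain ⟨r, hr, h'⟩ := hΔ.exists_imp_const _ h
  exact hΔ.const_notMem r hr (hΔ.mp h' (hΔ.mp (hΔ.const_of_lt 0 r hr) (hΔ.g2 _ _)))

theorem const_imp_const_notMem {r s : UnitRat} (h : r < s) : imp (const r) (const s) ∉ Δ :=
  fun h' => hΔ.const_notMem s (lt_of_le_of_lt r.2.1 h)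
    (hΔ.mp h' (hΔ.mp (hΔ.const_of_lt r s h) (hΔ.g2 _ _)))

/-- By maximality `φ` is at or above some constant `s > 0`, hence strictly above `s / 2`. -/
theorem exists_pos_const_imp_notMem {φ : PForm L} (h : φ ∉ Δ) :
    ∃ r : UnitRat, 0 < r ∧ imp (const r) φ ∉ Δ := by
  obtain ⟨s, hs, hs'⟩ := hΔ.exists_imp_const φ h
  have hs0 : (0 : ℚ) < s := hs
  have hs1 : (s : ℚ) ≤ 1 := s.2.2
  refine ⟨⟨s / 2, by positivity, by linarith⟩, half_pos hs0, fun h' => ?_⟩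
  exact hΔ.const_imp_const_notMem (r := ⟨s / 2, by positivity, by linarith⟩)
    (Subtype.mk_lt_mk.2 (half_lt_self hs0)) (hΔ.trans h' hs')

theorem imp_all_mem {x : ℕ} {φ ψ : PForm L} (h : ∀ t, imp ψ (φ.subst x t) ∈ Δ) :
    imp ψ (all x φ) ∈ Δ := by
  by_contra hno
  have key : ∀ χ, χ ∉ Δ → imp χ (all x φ) ∉ Δ → ∃ t, imp χ (φ.subst x t) ∉ Δ := fun χ hχ hχ' => by
    obtain ⟨t, ht⟩ := hΔ.exists_witness true x φ (some χ)
    exact ⟨t, fun h' => hχ (hΔ.mp h' (hΔ.mp (hΔ.imp_imp_left hχ') (ht 0)))⟩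
  -- The witnessing axiom is void for a true `ψ`; a positive constant strictly below `∀ x φ` then
  -- takes its place.
  by_cases hψ : ψ ∈ Δ
  · obtain ⟨r, hr, hr'⟩ := hΔ.exists_pos_const_imp_notMem
      (φ := all x φ) fun h' => hno (hΔ.weaken _ h')
    obtain ⟨t, ht⟩ := key _ (hΔ.const_notMem r hr) hr'
    exact ht (hΔ.weaken _ (hΔ.mp hψ (h t)))
  · obtain ⟨t, ht⟩ := key ψ hψ hno
    exact ht (h t)

/-- This supplies the instance with the same standard part as `∀ x φ` that the embedding needs to
preserve the supremum. -/
theorem exists_const_imp_subst_notMem (x : ℕ) (φ : PForm L) :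
    ∃ t, ∀ r, imp (const r) (all x φ) ∉ Δ → imp (const r) (φ.subst x t) ∉ Δ := by
  obtain ⟨t, ht⟩ := hΔ.exists_witness true x φ none
  have key : ∀ r : UnitRat, 0 < r → imp (const r) (all x φ) ∉ Δ →
      imp (const r) (φ.subst x t) ∉ Δ := fun r hr h h' =>
    hΔ.const_notMem r hr (hΔ.mp h' (hΔ.mp (hΔ.imp_imp_left h) (ht r)))
  refine ⟨t, fun r h h' => ?_⟩
  -- The constant `0` is true, so its axiom is void and a positive constant replaces it.
  rcases eq_or_lt_of_le (show 0 ≤ r from r.2.1) with rfl | hr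
  · obtain ⟨s, hs, hs'⟩ := hΔ.exists_pos_const_imp_notMem
      (φ := all x φ) fun h' => h (hΔ.weaken _ h')
    exact key s hs hs' (hΔ.weaken _ (hΔ.mp hΔ.const_zero_mem h'))
  · exact key r hr h h'

theorem ex_imp_mem {x : ℕ} {φ ψ : PForm L} (h : ∀ t, imp (φ.subst x t) ψ ∈ Δ) :
    imp (ex x φ) ψ ∈ Δ := by
  obtain ⟨t, ht⟩ := hΔ.exists_witness false x φ (some ψ)
  exact hΔ.mp (h t) (ht 0)

theorem exists_subst_imp_const_notMem (x : ℕ) (φ : PForm L) :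
    ∃ t, ∀ r, imp (ex x φ) (const r) ∉ Δ → imp (φ.subst x t) (const r) ∉ Δ := by
  obtain ⟨t, ht⟩ := hΔ.exists_witness false x φ none
  exact ⟨t, fun r h h' => h (hΔ.mp h' (ht r))⟩

/-- Formulas ordered by implication. -/
@[reducible] def preorder : Preorder (PForm L) where
  -- The order is reversed since truth is the least value.
  le φ ψ := imp ψ φ ∈ Δ
  le_refl φ := hΔ.refl φ
  le_trans _ _ _ h h' := hΔ.trans h' h

theorem exists_value [Countable (PForm L)] :
    ∃ h : PForm L → TruthValue, (∀ φ ψ, h φ ≤ h ψ ↔ imp ψ φ ∈ Δ) ∧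
      (∀ r, h (const r) = TruthValue.diag r) ∧
      (∀ x φ, IsLUB (Set.range fun t => h (φ.subst x t)) (h (all x φ))) ∧
      ∀ x φ, IsGLB (Set.range fun t => h (φ.subst x t)) (h (ex x φ)) := by
  classical
  let _ := hΔ.preorder
  have : @Std.Total (PForm L) (· ≤ ·) := ⟨fun φ ψ => hΔ.total ψ φ⟩
  let C := Antisymmetrization (PForm L) (· ≤ ·)
  let q : PForm L → C := toAntisymmetrization (· ≤ ·)
  have hq : ∀ φ ψ, q φ ≤ q ψ ↔ imp ψ φ ∈ Δ := fun φ ψ => Iff.rfl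
  have hq' : ∀ φ ψ, q φ < q ψ ↔ imp φ ψ ∉ Δ := fun φ ψ => by rw [← not_le, hq]
  have hsurj : Function.Surjective q := Quotient.mk_surjective
  have : Countable C := hsurj.countable
  obtain ⟨h, hmono, hcst, hlub, hglb⟩ := exists_truthValue_embedding (κ := fun r => q (const r))
    (fun r s hrs => (hq' _ _).2 (hΔ.const_imp_const_notMem hrs))
    (fun a => by
      obtain ⟨φ, rfl⟩ := hsurj a
      exact (hq _ _).2 (hΔ.weaken _ hΔ.const_zero_mem))
    (fun a => by
      obtain ⟨φ, rfl⟩ := hsurj a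
      exact (hq _ _).2 (hΔ.g7 _))
    (fun a ha => by
      obtain ⟨φ, rfl⟩ := hsurj a
      obtain ⟨r, hr, hr'⟩ := hΔ.exists_imp_const φ fun h' => (hq' _ _).1 ha (hΔ.weaken _ h')
      exact ⟨r, hr, (hq _ _).2 hr'⟩)
  refine ⟨fun φ => h (q φ), fun φ ψ => hmono.le_iff_le.trans (hq φ ψ), hcst,
    fun x φ => ?_, fun x φ => ?_⟩
  · have := hlub (Set.range fun t => q (φ.subst x t)) (q (all x φ)) ⟨?_, ?_⟩ ?_
    · rwa [← Set.range_comp] at this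
    · rintro _ ⟨t, rfl⟩
      exact (hq _ _).2 (hΔ.provable_subset (all_imp_subst_mem_provable T x t φ))
    · intro b hb
      obtain ⟨ψ, rfl⟩ := hsurj b
      exact (hq _ _).2 (hΔ.imp_all_mem fun t => (hq _ _).1 (hb ⟨t, rfl⟩))
    · obtain ⟨t, ht⟩ := hΔ.exists_const_imp_subst_notMem x φ
      exact ⟨_, ⟨t, rfl⟩, fun r hr => (hq' _ _).2 (ht r ((hq' _ _).1 hr))⟩
  · have := hglb (Set.range fun t => q (φ.subst x t)) (q (ex x φ)) ⟨?_, ?_⟩ ?_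
    · rwa [← Set.range_comp] at this
    · rintro _ ⟨t, rfl⟩
      exact (hq _ _).2 (hΔ.provable_subset (subst_imp_ex_mem_provable T x t φ))
    · intro b hb
      obtain ⟨ψ, rfl⟩ := hsurj b
      exact (hq _ _).2 (hΔ.ex_imp_mem fun t => (hq _ _).1 (hb ⟨t, rfl⟩))
    · obtain ⟨t, ht⟩ := hΔ.exists_subst_imp_const_notMem x φ
      exact ⟨_, ⟨t, rfl⟩, fun r hr => (hq' _ _).2 (ht r ((hq' _ _).1 hr))⟩

variable {h : PForm L → TruthValue} (hle : ∀ φ ψ, h φ ≤ h ψ ↔ imp ψ φ ∈ Δ)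
  (hcst : ∀ r, h (const r) = TruthValue.diag r)
include hle

theorem value_and (φ ψ : PForm L) : h (and φ ψ) = max (h φ) (h ψ) := by
  refine le_antisymm ?_ (max_le ((hle _ _).2 (hΔ.g2 _ _)) ((hle _ _).2 (hΔ.g2' _ _)))
  rcases hΔ.total φ ψ with h' | h'
  · exact ((hle _ _).2 (hΔ.imp_and (hΔ.refl _) h')).trans (le_max_left _ _)
  · exact ((hle _ _).2 (hΔ.imp_and h' (hΔ.refl _))).trans (le_max_right _ _)

include hcst

theorem value_of_mem {φ : PForm L} (hφ : φ ∈ Δ) : h φ = TruthValue.diag 0 := by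
  rw [← hcst]
  exact le_antisymm ((hle _ _).2 (hΔ.weaken _ hφ)) ((hle _ _).2 (hΔ.weaken _ hΔ.const_zero_mem))

theorem value_imp (φ ψ : PForm L) : h (imp φ ψ) = TruthValue.imp (h φ) (h ψ) := by
  unfold TruthValue.imp
  split_ifs with h'
  · exact hΔ.value_of_mem hle hcst ((hle _ _).1 h')
  · exact le_antisymm ((hle _ _).2 (hΔ.imp_imp _ _))
      ((hle _ _).2 (hΔ.imp_imp_self fun h'' => h' ((hle _ _).2 h'')))

end Saturated

/-! ### The term model -/

/-- Simultaneous substitution of terms with parameters for the variables of a formula. -/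
def inst : (ℕ → L.Term (ℕ ⊕ ℕ)) → Formula L → PForm L
  | _, .const r => const r
  | τ, .rel R ts => rel R fun i => (ts i).subst τ
  | τ, .and φ ψ => and (inst τ φ) (inst τ ψ)
  | τ, .imp φ ψ => imp (inst τ φ) (inst τ ψ)
  -- The bound variable is kept; nothing is captured when the other variables receive closed terms,
  -- as in `subst_inst_closedTerm`.
  | τ, .all x φ => all x (inst (Function.update τ x (Term.var (Sum.inl x))) φ)
  | τ, .ex x φ => ex x (inst (Function.update τ x (Term.var (Sum.inl x))) φ)

theorem psubstTerm_closedTerm (x : ℕ) (t s : L.Term ℕ) :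
    psubstTerm x t (closedTerm s) = closedTerm s := by
  induction s with
  | var a => simp [psubstTerm, closedTerm, Term.relabel, Term.subst]
  | func g ts ih =>
    simp only [psubstTerm, closedTerm, Term.relabel, Term.subst] at ih ⊢
    congr 1
    funext i
    exact ih i

theorem psubstTerm_subst (x : ℕ) (t : L.Term ℕ) (τ : ℕ → L.Term (ℕ ⊕ ℕ)) (s : L.Term ℕ) :
    psubstTerm x t (s.subst τ) = s.subst fun z => psubstTerm x t (τ z) := by
  induction s with
  | var a => rfl
  | func g ts ih =>
    simp only [psubstTerm, Term.subst] at ih ⊢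
    congr 1
    funext i
    exact ih i

theorem subst_eq_self {t : L.Term ℕ} {τ : ℕ → L.Term (ℕ ⊕ ℕ)} (N : ℕ)
    (hτ : ∀ z ∈ t.varFinset, τ z = Term.var (Sum.inl z)) : trTerm N (t.subst τ) = t := by
  induction t with
  | var a => simp [Term.subst, hτ a (by simp [Term.varFinset]), trTerm]
  | func g ts ih =>
    simp only [trTerm, Term.subst, Term.relabel] at ih ⊢
    congr 1
    funext i
    exact ih i fun z hz => hτ z (by
      simp only [Term.varFinset, Finset.mem_biUnion, Finset.mem_univ, true_and]
      exact ⟨i, hz⟩)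

theorem tr_inst {φ : Formula L} {τ : ℕ → L.Term (ℕ ⊕ ℕ)} (N : ℕ)
    (hτ : ∀ z ∈ φ.freeVars, τ z = Term.var (Sum.inl z)) : (inst τ φ).tr N = φ := by
  induction φ generalizing τ with
  | const r => rfl
  | rel R ts =>
    simp only [inst, tr]
    congr 1
    funext i
    exact subst_eq_self N fun z hz => hτ z (Finset.mem_biUnion.2 ⟨i, Finset.mem_univ i, hz⟩)
  | and φ ψ ih ih' =>
    simp only [inst, tr, ih fun z hz => hτ z (Finset.mem_union_left _ hz),
      ih' fun z hz => hτ z (Finset.mem_union_right _ hz)]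
  | imp φ ψ ih ih' =>
    simp only [inst, tr, ih fun z hz => hτ z (Finset.mem_union_left _ hz),
      ih' fun z hz => hτ z (Finset.mem_union_right _ hz)]
  | all y φ ih =>
    simp only [inst, tr]
    rw [ih fun z hz => ?_]
    by_cases hzy : z = y
    · simp [hzy]
    · rw [Function.update_of_ne hzy]
      exact hτ z (Finset.mem_erase.2 ⟨hzy, hz⟩)
  | ex y φ ih =>
    simp only [inst, tr]
    rw [ih fun z hz => ?_]
    by_cases hzy : z = y
    · simp [hzy]
    · rw [Function.update_of_ne hzy]
      exact hτ z (Finset.mem_erase.2 ⟨hzy, hz⟩)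

theorem psubstTerm_update {x y : ℕ} {t : L.Term ℕ} (τ : ℕ → L.Term (ℕ ⊕ ℕ)) (hy : y ≠ x) :
    (fun z => psubstTerm x t (Function.update τ y (Term.var (Sum.inl y)) z)) =
      Function.update (fun z => psubstTerm x t (τ z)) y (Term.var (Sum.inl y)) := by
  funext z
  by_cases hzy : z = y
  · subst hzy; simp [psubstTerm, Term.subst, hy]
  · simp [hzy]

theorem psubstTerm_update_of_ne {x y : ℕ} {t : L.Term ℕ} {τ : ℕ → L.Term (ℕ ⊕ ℕ)}
    (hτ : ∀ z, z ≠ x → psubstTerm x t (τ z) = τ z) (hy : y ≠ x) (z : ℕ) (hz : z ≠ x) :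
    psubstTerm x t (Function.update τ y (Term.var (Sum.inl y)) z) =
      Function.update τ y (Term.var (Sum.inl y)) z := by
  by_cases hzy : z = y
  · subst hzy; simp [psubstTerm, Term.subst, hy]
  · simpa [hzy] using hτ z hz

theorem update_psubstTerm {x : ℕ} {t : L.Term ℕ} {τ : ℕ → L.Term (ℕ ⊕ ℕ)}
    (hτ : ∀ z, z ≠ x → psubstTerm x t (τ z) = τ z) :
    Function.update (fun z => psubstTerm x t (τ z)) x (Term.var (Sum.inl x)) =
      Function.update τ x (Term.var (Sum.inl x)) := by
  funext z
  by_cases hz : z = x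
  · subst hz; simp
  · simp [hz, hτ z hz]

/-- The hypothesis amounts to `x` not occurring in the terms put for other variables; so below a
quantifier on `x` neither side changes anything. -/
theorem subst_inst {x : ℕ} {t : L.Term ℕ} (φ : Formula L) {τ : ℕ → L.Term (ℕ ⊕ ℕ)}
    (hτ : ∀ z, z ≠ x → psubstTerm x t (τ z) = τ z) :
    (inst τ φ).subst x t = inst (fun z => psubstTerm x t (τ z)) φ := by
  induction φ generalizing τ with
  | const r => rfl
  | rel R ts => simp only [inst, PForm.subst, psubstTerm_subst]
  | and φ ψ ih ih' => simp only [inst, PForm.subst, ih hτ, ih' hτ]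
  | imp φ ψ ih ih' => simp only [inst, PForm.subst, ih hτ, ih' hτ]
  | all y φ ih =>
    by_cases hy : y = x
    · subst hy
      simp only [inst, PForm.subst, if_true, update_psubstTerm hτ]
    · simp only [inst, PForm.subst, if_neg hy, ih (psubstTerm_update_of_ne hτ hy),
        psubstTerm_update τ hy]
  | ex y φ ih =>
    by_cases hy : y = x
    · subst hy
      simp only [inst, PForm.subst, if_true, update_psubstTerm hτ]
    · simp only [inst, PForm.subst, if_neg hy, ih (psubstTerm_update_of_ne hτ hy),
        psubstTerm_update τ hy]

theorem subst_inst_closedTerm (x : ℕ) (t : L.Term ℕ) (φ : Formula L) (τ : ℕ → L.Term ℕ) :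
    (inst (Function.update (fun z => closedTerm (τ z)) x (Term.var (Sum.inl x))) φ).subst x t =
      inst (fun z => closedTerm (Function.update τ x t z)) φ := by
  rw [subst_inst]
  · congr 1
    funext z
    by_cases hz : z = x
    · subst hz; simp [psubstTerm, Term.subst]
    · simp [hz, psubstTerm_closedTerm]
  · intro z hz
    simp [hz, psubstTerm_closedTerm]

/-- The term model of a valuation of the formulas with parameters. -/
noncomputable def termModel [Small.{w} (L.Term ℕ)] (h : PForm L → TruthValue) :
    Model.{u, v, w} L where
  -- Terms of a countable language are countable, so they fit into any universe.
  carrier := Shrink.{w} (L.Term ℕ)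
  nonempty := ⟨equivShrink _ (Term.var 0)⟩
  funMap f ts := equivShrink _ (Term.func f fun i => (equivShrink _).symm (ts i))
  relMap R ts := h (rel R fun i => closedTerm ((equivShrink _).symm (ts i)))

theorem closedTerm_termValue [Small.{w} (L.Term ℕ)] (h : PForm L → TruthValue)
    (τ : ℕ → L.Term ℕ) (t : L.Term ℕ) :
    closedTerm ((equivShrink _).symm
      ((termModel.{u, v, w} h).termValue (fun z => equivShrink _ (τ z)) t)) =
      t.subst fun z => closedTerm (τ z) := by
  induction t with
  | var a => simp [Model.termValue, Term.subst]
  | func g ts ih =>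
    simp only [Model.termValue, termModel, Equiv.symm_apply_apply, Term.subst, closedTerm,
      Term.relabel] at ih ⊢
    congr 1
    funext i
    exact ih i

theorem TruthValue.sup_eq {S : Set TruthValue} {a : TruthValue} (h : IsLUB S a) :
    TruthValue.sup S = a := (TruthValue.isLUB_sup S).unique h

theorem TruthValue.inf_eq {S : Set TruthValue} {a : TruthValue} (h : IsGLB S a) :
    TruthValue.inf S = a := (TruthValue.isGLB_inf S).unique h

theorem value_termModel [Small.{w} (L.Term ℕ)] {h : PForm L → TruthValue}
    (hconst : ∀ r, h (const r) = TruthValue.diag r)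
    (hand : ∀ φ ψ, h (and φ ψ) = max (h φ) (h ψ))
    (himp : ∀ φ ψ, h (imp φ ψ) = TruthValue.imp (h φ) (h ψ))
    (hall : ∀ x φ, IsLUB (Set.range fun t => h (φ.subst x t)) (h (all x φ)))
    (hex : ∀ x φ, IsGLB (Set.range fun t => h (φ.subst x t)) (h (ex x φ)))
    (φ : Formula L) (τ : ℕ → L.Term ℕ) :
    (termModel.{u, v, w} h).value (fun z => equivShrink _ (τ z)) φ =
      h (inst (fun z => closedTerm (τ z)) φ) := by
  have hrange : ∀ (x : ℕ) (φ : Formula L) (τ : ℕ → L.Term ℕ),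
      (∀ τ : ℕ → L.Term ℕ, (termModel.{u, v, w} h).value (fun z => equivShrink _ (τ z)) φ =
        h (inst (fun z => closedTerm (τ z)) φ)) →
      (Set.range fun a : (termModel.{u, v, w} h).carrier => (termModel.{u, v, w} h).value
        (Function.update (fun z => equivShrink _ (τ z)) x a) φ) =
      Set.range fun t => h ((inst (Function.update (fun z => closedTerm (τ z)) x
        (Term.var (Sum.inl x))) φ).subst x t) := fun x φ τ ih => by
    refine ((equivShrink (L.Term ℕ)).surjective.range_comp _).symm.trans ?_
    congr 1
    funext t
    rw [subst_inst_closedTerm, ← ih]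
    change (termModel.{u, v, w} h).value (Function.update _ x _) φ = _
    congr 1
    funext z
    by_cases hz : z = x
    · subst hz
      exact (Function.update_self _ _ _).trans (by rw [Function.update_self])
    · exact (Function.update_of_ne hz _ _).trans (by rw [Function.update_of_ne hz])
  induction φ generalizing τ with
  | const r => exact (hconst r).symm
  | rel R ts =>
    simp only [Model.value, inst]
    change h (rel R fun i => closedTerm ((equivShrink _).symm _)) = _
    congr 2
    funext i
    exact closedTerm_termValue h τ (ts i)
  | and φ ψ ih ih' => simp only [Model.value, inst, hand, ih, ih']
  | imp φ ψ ih ih' => simp only [Model.value, inst, himp, ih, ih']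
  | all x φ ih =>
    simp only [Model.value, inst]
    rw [hrange x φ τ ih]
    exact TruthValue.sup_eq (hall _ _)
  | ex x φ ih =>
    simp only [Model.value, inst]
    rw [hrange x φ τ ih]
    exact TruthValue.inf_eq (hex _ _)

/-- Without free variables, instantiation followed by translation changes nothing. -/
theorem inst_mem_provable {T : Theory L} {φ : Sentence L} (hφ : φ ∈ T)
    (τ : ℕ → L.Term (ℕ ⊕ ℕ)) : inst τ φ.1 ∈ provable T := by
  refine .of_forall fun N => ?_
  rw [tr_inst N fun z hz => absurd hz (by rw [φ.2]; exact Finset.notMem_empty z)]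
  exact .hyp hφ

end RGL

theorem theorem2 (L : FirstOrder.Language.{u, v})
    [Countable (Σ n, L.Functions n)] [Countable (Σ n, L.Relations n)]
    (T : RGL.Theory L) (hT : RGL.StronglyConsistent T) :
    RGL.Satisfiable.{u, v, w} T := by
  obtain ⟨Δ, hΔ⟩ := RGL.exists_saturated hT
  obtain ⟨h, hle, hcst, hall, hex⟩ := hΔ.exists_value
  refine ⟨RGL.termModel.{u, v, w} h, fun φ hφ σ => ?_⟩
  obtain ⟨τ, rfl⟩ : ∃ τ : ℕ → L.Term ℕ, σ = fun z => equivShrink.{w} (L.Term ℕ) (τ z) :=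
    ⟨fun z => (equivShrink.{w} (L.Term ℕ)).symm (σ z),
      funext fun z => ((equivShrink.{w} (L.Term ℕ)).apply_symm_apply (σ z)).symm⟩
  exact (RGL.value_termModel.{u, v, w} hcst (hΔ.value_and hle) (hΔ.value_imp hle hcst) hall hex
    φ.1 τ).trans
    (hΔ.value_of_mem hle hcst (hΔ.provable_subset (RGL.inst_mem_provable hφ _)))
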